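/- Let $d\ge 2$ be an integer and $\mathbb{T}^d=\mathbb{R}^d/2\pi\mathbb{Z}^d$. For $m\in\mathbb{N}$ let $H^m$ be the Sobolev space of real functions $u\in H^m(\mathbb{T}^d)$ with $\int_{\mathbb{T}^d}u\,dx=0$, normed by $\|u\|_m=\|(-\Delta)^{m/2}u\|_{L^2(\mathbb{T}^d)}$, and let $H^m(\mathbb{T}^d;\mathbb{R}^d)$ be the space of vector fields $v=(v_1,\dots,v_d)$ with $v_j\in H^m$, normed by $\big(\sum_{j=1}^d\|v_j\|_m^2\big)^{1/2}$; let $H^m_\sigma$ be its subspace of divergence-free fields. For $T>0$ put $J_T=[0,T]$. Let $T>0$, $R>0$ and $k\in\mathbb{N}$ with $k>d/2$. Then there exists a constant $C=C(R,T,k,d)>0$ such that the following holds. Let $f\in H^{k+2}$ and $v_1,v_2\in C(J_T;H^{k+2}_\sigma)$ satisfy $$\|f\|_{k+2}+\|v_1\|_{C(J_T;H^{k+2}_\sigma)}+\|v_2\|_{C(J_T;H^{k+2}_\sigma)}\le R,$$ and for $i=1,2$ let $$\varphi_{v_i}\in C(J_T;H^{k+2})\cap L^2(J_T;H^{k+3})\cap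 H^1(J_T;H^{k+1})$$ be the solution of the advection–diffusion equation $$\frac{\partial\varphi_{v_i}}{\partial t}+v_i\cdot\nabla\varphi_{v_i}-\Delta\varphi_{v_i}=0\quad\text{in }J_T\times\mathbb{T}^d,\qquad \varphi_{v_i}(0,\cdot)=f .$$ Then $$\|\varphi_{v_1}-\varphi_{v_2}\|_{C(J_T;H^k)}\le C\,|||v_1-v_2|||_{T,k}^{1/2},\qquad |||v|||_{T,k}:=\sup_{t\in J_T}\Big\|\int_0^t v(s)\,ds\Big\|_{H^k(\mathbb{T}^d;\mathbb{R}^d)} .$$ -/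

import Mathlib

noncomputable section

namespace AdvDiff

open MeasureTheory Complex

instance two_pi_pos_fact : Fact (0 < 2 * Real.pi) := ⟨Real.two_pi_pos⟩

/-- The torus `𝕋^d = ℝ^d / 2πℤ^d`, with the Lebesgue measure, of total mass `(2π)^d`. -/
abbrev Torus (d : ℕ) : Type := Fin d → AddCircle (2 * Real.pi)

/-- The space `L²(𝕋^d)` of real functions. -/
abbrev L2 (d : ℕ) : Type := Lp ℝ 2 (volume : Measure (Torus d))

/-- The character `x ↦ e^{i n·x}` of `𝕋^d`. -/
def character {d : ℕ} (n : Fin d → ℤ) : C(Torus d, ℂ) where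
  toFun x := ∏ j, fourier (n j) (x j)
  continuous_toFun := by fun_prop

theorem character_add {d : ℕ} (m n : Fin d → ℤ) :
    character (m + n) = character m * character n := by
  ext x
  simp only [character, Pi.add_apply, fourier_apply, fourier_add', Finset.prod_mul_distrib,
      ContinuousMap.coe_mk, ContinuousMap.mul_apply]

theorem character_neg {d : ℕ} (n : Fin d → ℤ) : character (-n) = star (character n) := by
  ext x
  simp only [character, Pi.neg_apply, fourier_neg, ContinuousMap.coe_mk, ContinuousMap.star_apply,
    star_prod, starRingEnd_apply]

theorem character_zero {d : ℕ} : character (0 : Fin d → ℤ) = 1 := by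
  ext x
  simp [character]

theorem norm_character_apply {d : ℕ} (n : Fin d → ℤ) (x : Torus d) : ‖character n x‖ = 1 := by
  simp only [character, ContinuousMap.coe_mk, fourier_apply, norm_prod, Circle.norm_coe,
    Finset.prod_const_one]

theorem integral_fourier_ne {n : ℤ} (hn : n ≠ 0) :
    ∫ x : AddCircle (2 * Real.pi), fourier n x = 0 := by
  have h := (orthonormal_iff_ite.mp (orthonormal_fourier (T := 2 * Real.pi))) 0 n
  rw [if_neg (Ne.symm hn)] at h
  simp only [ContinuousMap.inner_toLp] at h
  rw [AddCircle.volume_eq_smul_haarAddCircle, integral_smul_measure]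
  simp only [fourier_zero, map_one, mul_one] at h
  rw [h, smul_zero]

theorem integral_character {d : ℕ} (n : Fin d → ℤ) :
    ∫ x, character n x = if n = 0 then ((2 * Real.pi : ℝ) : ℂ) ^ d else 0 := by
  split_ifs with h
  · subst h
    simp only [character_zero, ContinuousMap.one_apply, integral_const, measureReal_def,
      volume_pi, Measure.pi_univ, AddCircle.measure_univ, Finset.prod_const, Finset.card_univ,
      Fintype.card_fin, ENNReal.toReal_pow, ENNReal.toReal_ofReal Real.two_pi_pos.le]
    simp
  · simp only [character, ContinuousMap.coe_mk]
    rw [integral_fintype_prod_volume_eq_prod]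
    obtain ⟨i, hi⟩ := Function.ne_iff.mp h
    exact Finset.prod_eq_zero (Finset.mem_univ i) (integral_fourier_ne hi)

/-- The normalised character `(2π)^{-d/2} e^{i n·x}`. -/
def normChar {d : ℕ} (n : Fin d → ℤ) : C(Torus d, ℂ) :=
  (((Real.sqrt ((2 * Real.pi) ^ d))⁻¹ : ℝ) : ℂ) • character n

theorem orthonormal_normChar {d : ℕ} : Orthonormal ℂ (fun n : Fin d → ℤ =>
    ContinuousMap.toLp (E := ℂ) 2 (volume : Measure (Torus d)) ℂ (normChar n)) := by
  rw [orthonormal_iff_ite]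
  intro m n
  have hpos : (0 : ℝ) < (2 * Real.pi) ^ d := pow_pos Real.two_pi_pos d
  have hs := Real.mul_self_sqrt hpos.le
  have hs0 := (Real.sqrt_pos.2 hpos).ne'
  simp only [ContinuousMap.inner_toLp]
  have : ∀ x : Torus d, normChar n x * (starRingEnd ℂ) (normChar m x)
      = (((2 * Real.pi) ^ d : ℝ) : ℂ)⁻¹ * character (n - m) x := by
    intro x
    rw [sub_eq_add_neg, character_add, character_neg, ← hs]
    simp [normChar]
    ring
  simp only [this]
  rw [integral_const_mul, integral_character]
  by_cases h : m = n
  · subst h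
    have := hpos.ne'
    rw [if_pos (sub_self m), if_pos rfl]
    rw [← Complex.ofReal_pow]
    exact inv_mul_cancel₀ (by exact_mod_cast this)
  · rw [if_neg (sub_ne_zero.2 (Ne.symm h)), if_neg h, mul_zero]

theorem span_character_closure {d : ℕ} :
    (Submodule.span ℂ (Set.range (character (d := d)))).topologicalClosure = ⊤ := by
  let A : StarSubalgebra ℂ C(Torus d, ℂ) :=
    { toSubalgebra := Algebra.adjoin ℂ (Set.range character)
      star_mem' := by
        change Algebra.adjoin ℂ (Set.range character) ≤
          star (Algebra.adjoin ℂ (Set.range character))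
        refine Algebra.adjoin_le ?_
        rintro _ ⟨n, rfl⟩
        exact Algebra.subset_adjoin ⟨-n, character_neg n⟩ }
  have hA : A.toSubalgebra.toSubmodule = Submodule.span ℂ (Set.range (character (d := d))) := by
    apply Algebra.adjoin_eq_span_of_subset
    refine .trans (fun x ↦ Submonoid.closure_induction (fun _ ↦ id) ⟨0, character_zero⟩ ?_)
      Submodule.subset_span
    rintro _ _ _ _ ⟨m, rfl⟩ ⟨n, rfl⟩
    exact ⟨m + n, character_add m n⟩
  have hsep : A.SeparatesPoints := by
    intro x y hxy
    rw [Ne, funext_iff, not_forall] at hxy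
    obtain ⟨i, hi⟩ := hxy
    refine ⟨_, ⟨character (Pi.single i 1), Algebra.subset_adjoin ⟨Pi.single i 1, rfl⟩, rfl⟩, ?_⟩
    have key : ∀ z : Torus d, character (Pi.single i 1) z = fourier 1 (z i) := by
      intro z
      simp only [character, ContinuousMap.coe_mk]
      rw [Finset.prod_eq_single i]
      · simp
      · intro j _ hj
        simp [Pi.single_eq_of_ne hj]
      · simp
    change character (Pi.single i 1) x ≠ character (Pi.single i 1) y
    rw [key, key, fourier_one, fourier_one]
    intro h
    exact hi (AddCircle.injective_toCircle Real.two_pi_pos.ne' (Circle.ext h))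
  rw [← hA]
  exact congr_arg (Subalgebra.toSubmodule <| StarSubalgebra.toSubalgebra ·)
    (ContinuousMap.starSubalgebra_topologicalClosure_eq_top_of_separatesPoints A hsep)

/-- The normalised characters are a Hilbert basis of the complex space `L²(𝕋^d)`. -/
def charBasis (d : ℕ) :
    HilbertBasis (Fin d → ℤ) ℂ (Lp ℂ 2 (volume : Measure (Torus d))) :=
  HilbertBasis.mk orthonormal_normChar (by
    have h := (ContinuousMap.toLp_denseRange ℂ (volume : Measure (Torus d)) ℂ
        (p := 2) (by simp)).topologicalClosure_map_submodule span_character_closure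
    rw [← h]
    refine Submodule.topologicalClosure_mono ?_
    rw [Submodule.map_span_le]
    rintro _ ⟨n, rfl⟩
    have h0 : Real.sqrt ((2 * Real.pi) ^ d) ≠ 0 :=
      (Real.sqrt_pos.2 (pow_pos Real.two_pi_pos d)).ne'
    have : character n = ((Real.sqrt ((2 * Real.pi) ^ d) : ℝ) : ℂ) • normChar n := by
      rw [normChar, smul_smul, ← Complex.ofReal_mul, mul_inv_cancel₀ h0]
      simp
    rw [this, map_smul]
    exact Submodule.smul_mem _ _ (Submodule.subset_span ⟨n, rfl⟩))

/-- The Fourier coefficient `û(n) = (2π)^{-d} ∫ u(x) e^{-i n·x} dx`. -/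
def torusCoeff {d : ℕ} (u : Torus d → ℝ) (n : Fin d → ℤ) : ℂ :=
  (((2 * Real.pi) ^ d : ℝ) : ℂ)⁻¹ * ∫ x, character (-n) x * (u x : ℂ)

/-- Parseval's identity. -/
theorem parseval {d : ℕ} (u : L2 d) :
    HasSum (fun n => (2 * Real.pi) ^ d * ‖torusCoeff u n‖ ^ 2) (‖u‖ ^ 2) := by
  have hu : MemLp (fun x => ((u x : ℝ) : ℂ)) 2 (volume : Measure (Torus d)) := (Lp.memLp u).ofReal
  set U : Lp ℂ 2 (volume : Measure (Torus d)) := hu.toLp with hU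
  have hpos : (0 : ℝ) < (2 * Real.pi) ^ d := pow_pos Real.two_pi_pos d
  have hnorm : ‖U‖ = ‖u‖ := by
    rw [hU, Lp.norm_toLp, Lp.norm_def]
    congr 1
    exact eLpNorm_congr_norm_ae (by filter_upwards with x; simp)
  have hrepr : ∀ n, (charBasis d).repr U n =
      ((Real.sqrt ((2 * Real.pi) ^ d) : ℝ) : ℂ) * torusCoeff u n := by
    intro n
    rw [HilbertBasis.repr_apply_apply, charBasis, HilbertBasis.coe_mk, L2.inner_def, torusCoeff,
      ← mul_assoc, ← integral_const_mul]
    apply integral_congr_ae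
    filter_upwards [ContinuousMap.coeFn_toLp (p := 2) (𝕜 := ℂ)
      (volume : Measure (Torus d)) (normChar n),
      hu.coeFn_toLp] with x h1 h2
    rw [h1, h2]
    have hs := Real.mul_self_sqrt hpos.le
    have hs0 := (Real.sqrt_pos.2 hpos).ne'
    have : ((((2 * Real.pi) ^ d : ℝ)) : ℂ)⁻¹ =
        (((Real.sqrt ((2 * Real.pi) ^ d) : ℝ) : ℂ))⁻¹ * (((Real.sqrt ((2 * Real.pi) ^ d) : ℝ) : ℂ))⁻¹ := by
      rw [← mul_inv, ← Complex.ofReal_mul, hs]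
    have hs1 : ((Real.sqrt ((2 * Real.pi) ^ d) : ℝ) : ℂ) ≠ 0 := by exact_mod_cast hs0
    rw [this, mul_inv_cancel_left₀ hs1, RCLike.inner_apply, character_neg]
    simp [normChar]
    ring
  have h := lp.hasSum_norm (p := 2) (by simp) ((charBasis d).repr U)
  rw [LinearIsometryEquiv.norm_map, hnorm] at h
  simp only [hrepr, norm_mul, ENNReal.toReal_ofNat, Real.rpow_ofNat] at h
  refine h.congr_fun fun n => ?_
  generalize (2 * Real.pi) ^ d = P at hpos ⊢
  rw [mul_pow, Complex.norm_real, Real.norm_eq_abs, sq_abs, Real.sq_sqrt hpos.le]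

theorem integrable_character_mul {d : ℕ} (u : L2 d) (n : Fin d → ℤ) :
    Integrable (fun x => character n x * ((u x : ℝ) : ℂ)) := by
  have hu : Integrable (fun x => ((u x : ℝ) : ℂ)) (volume : Measure (Torus d)) :=
    ((Lp.memLp u).integrable (by norm_num)).ofReal
  exact hu.bdd_mul (c := 1) (character n).continuous.aestronglyMeasurable
    (Filter.Eventually.of_forall fun x => (norm_character_apply n x).le)

theorem torusCoeff_add {d : ℕ} (u w : L2 d) (n : Fin d → ℤ) :
    torusCoeff (u + w : L2 d) n = torusCoeff u n + torusCoeff w n := by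
  simp only [torusCoeff]
  rw [← mul_add, ← integral_add (integrable_character_mul u _) (integrable_character_mul w _)]
  congr 1
  apply integral_congr_ae
  filter_upwards [Lp.coeFn_add u w] with x hx
  rw [hx, Pi.add_apply]
  push_cast
  ring

theorem torusCoeff_smul {d : ℕ} (c : ℝ) (u : L2 d) (n : Fin d → ℤ) :
    torusCoeff (c • u : L2 d) n = c * torusCoeff u n := by
  simp only [torusCoeff]
  rw [mul_left_comm, ← integral_const_mul (c : ℂ)]
  congr 1
  apply integral_congr_ae
  filter_upwards [Lp.coeFn_smul c u] with x hx
  rw [hx, Pi.smul_apply, smul_eq_mul]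
  push_cast
  ring

theorem torusCoeff_zero {d : ℕ} (n : Fin d → ℤ) : torusCoeff (0 : L2 d) n = 0 := by
  simpa using torusCoeff_smul 0 (0 : L2 d) n

/-- The length `|n|` of a frequency `n ∈ ℤ^d`. -/
def freq {d : ℕ} (n : Fin d → ℤ) : ℝ := Real.sqrt (∑ j, (n j : ℝ) ^ 2)

theorem one_le_freq {d : ℕ} {n : Fin d → ℤ} (hn : n ≠ 0) : 1 ≤ freq n := by
  obtain ⟨i, hi⟩ := Function.ne_iff.mp hn
  rw [freq, Real.one_le_sqrt]
  have h1 : (1 : ℝ) ≤ (n i : ℝ) ^ 2 := by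
    have h2 : 0 < (n i) ^ 2 := by
      have : n i ≠ 0 := hi
      positivity
    have h3 : (1 : ℤ) ≤ (n i) ^ 2 := by omega
    exact_mod_cast h3
  exact h1.trans (Finset.single_le_sum (f := fun j => (n j : ℝ) ^ 2)
    (fun j _ => sq_nonneg _) (Finset.mem_univ i))

theorem memlp_iff {d : ℕ} (k : ℕ) (u : L2 d) :
    Memℓp (fun n => ((Real.sqrt ((2 * Real.pi) ^ d) * freq n ^ k : ℝ) : ℂ) * torusCoeff u n) 2 ↔
      Summable fun n => freq n ^ (2 * k) * ‖torusCoeff u n‖ ^ 2 := by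
  have hpos : (0 : ℝ) < (2 * Real.pi) ^ d := pow_pos Real.two_pi_pos d
  rw [memℓp_gen_iff (by norm_num)]
  have : ∀ n, ‖((Real.sqrt ((2 * Real.pi) ^ d) * freq n ^ k : ℝ) : ℂ) * torusCoeff u n‖
      ^ (2 : ENNReal).toReal = (2 * Real.pi) ^ d * (freq n ^ (2 * k) * ‖torusCoeff u n‖ ^ 2) := by
    intro n
    rw [ENNReal.toReal_ofNat, Real.rpow_ofNat, norm_mul, Complex.norm_real, Real.norm_eq_abs,
      mul_pow, sq_abs, mul_pow, Real.sq_sqrt hpos.le]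
    ring
  simp only [this]
  exact summable_mul_left_iff hpos.ne'

/-- The Sobolev space `H^k` of real functions `u ∈ L²(𝕋^d)` of zero average whose derivatives up
to order `k` are in `L²`, that is, with `∑ |n|^{2k} |û(n)|² < ∞`; as a subspace of `L²`. -/
def sobolevSubmodule (d k : ℕ) : Submodule ℝ (L2 d) where
  carrier := {u | ∫ x, u x = 0 ∧ Summable fun n => freq n ^ (2 * k) * ‖torusCoeff u n‖ ^ 2}
  zero_mem' := by
    refine ⟨?_, summable_zero.congr fun n => by rw [torusCoeff_zero]; simp⟩
    rw [integral_congr_ae (Lp.coeFn_zero ℝ 2 volume)]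
    simp
  add_mem' := by
    rintro u w ⟨hu, hu'⟩ ⟨hw, hw'⟩
    refine ⟨?_, ?_⟩
    · rw [integral_congr_ae (Lp.coeFn_add u w)]
      simp only [Pi.add_apply]
      rw [integral_add ((Lp.memLp u).integrable (by norm_num))
        ((Lp.memLp w).integrable (by norm_num)), hu, hw, add_zero]
    · rw [← memlp_iff] at hu' hw' ⊢
      convert hu'.add hw' using 1
      ext n
      rw [torusCoeff_add, Pi.add_apply, mul_add]
  smul_mem' := by
    rintro c u ⟨hu, hu'⟩
    refine ⟨?_, ?_⟩
    · rw [integral_congr_ae (Lp.coeFn_smul c u)]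
      simp only [Pi.smul_apply, smul_eq_mul]
      rw [integral_const_mul, hu, mul_zero]
    · have : ∀ n, freq n ^ (2 * k) * ‖torusCoeff (c • u : L2 d) n‖ ^ 2 =
          c ^ 2 * (freq n ^ (2 * k) * ‖torusCoeff u n‖ ^ 2) := by
        intro n
        rw [torusCoeff_smul, norm_mul, Complex.norm_real, Real.norm_eq_abs, mul_pow, sq_abs]
        ring
      simp only [this]
      exact hu'.mul_left _

/-- The Sobolev space `H^k` of zero average functions on `𝕋^d`, as a type of its own: its norm
(see `Sobolev.norm_sq`) is not the `L²` norm. -/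
def Sobolev (d k : ℕ) : Type := sobolevSubmodule d k

namespace Sobolev

instance {d k : ℕ} : AddCommGroup (Sobolev d k) :=
  inferInstanceAs (AddCommGroup (sobolevSubmodule d k))

instance {d k : ℕ} : Module ℝ (Sobolev d k) :=
  inferInstanceAs (Module ℝ (sobolevSubmodule d k))

/-- The inclusion `H^k ⊆ L²(𝕋^d)`. -/
def toL2 {d k : ℕ} : Sobolev d k →ₗ[ℝ] L2 d := (sobolevSubmodule d k).subtype

theorem toL2_mem {d k : ℕ} (u : Sobolev d k) : toL2 u ∈ sobolevSubmodule d k := Subtype.property u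

theorem toL2_injective {d k : ℕ} : Function.Injective (toL2 : Sobolev d k → L2 d) :=
  Subtype.coe_injective

/-- The element of `H^k` given by a function of `L²(𝕋^d)`. -/
def mk {d k : ℕ} (u : L2 d) (hu : u ∈ sobolevSubmodule d k) : Sobolev d k :=
  (⟨u, hu⟩ : sobolevSubmodule d k)

theorem toL2_mk {d k : ℕ} (u : L2 d) (hu : u ∈ sobolevSubmodule d k) : toL2 (mk u hu) = u := rfl

/-- The square summable sequence `(2π)^{d/2} |n|^k û(n)`. -/
def weightedCoeff {d k : ℕ} : Sobolev d k →ₗ[ℝ] lp (fun _ : Fin d → ℤ => ℂ) 2 where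
  toFun u := ⟨fun n => ((Real.sqrt ((2 * Real.pi) ^ d) * freq n ^ k : ℝ) : ℂ) *
    torusCoeff (toL2 u) n, (memlp_iff k _).2 (toL2_mem u).2⟩
  map_add' u w := by
    ext n
    simp only [map_add, torusCoeff_add, mul_add]
    rfl
  map_smul' c u := by
    ext n
    simp only [map_smul, torusCoeff_smul, mul_left_comm _ (c : ℂ)]
    rfl

theorem torusCoeff_toL2_zero {d k : ℕ} (u : Sobolev d k) : torusCoeff (toL2 u) 0 = 0 := by
  rw [torusCoeff, neg_zero, character_zero]
  simp only [ContinuousMap.one_apply, one_mul]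
  rw [integral_complex_ofReal, (toL2_mem u).1]
  simp

theorem norm_weightedCoeff_sq {d k : ℕ} (u : Sobolev d k) : HasSum
    (fun n => (2 * Real.pi) ^ d * (freq n ^ (2 * k) * ‖torusCoeff (toL2 u) n‖ ^ 2))
    (‖weightedCoeff u‖ ^ 2) := by
  have hpos : (0 : ℝ) < (2 * Real.pi) ^ d := pow_pos Real.two_pi_pos d
  have h := lp.hasSum_norm (p := 2) (by simp) (weightedCoeff u)
  simp only [ENNReal.toReal_ofNat, Real.rpow_ofNat] at h
  refine h.congr_fun fun n => ?_
  simp only [weightedCoeff, LinearMap.coe_mk, AddHom.coe_mk]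
  generalize (2 * Real.pi) ^ d = P at hpos ⊢
  rw [norm_mul, Complex.norm_real, Real.norm_eq_abs,
      mul_pow, sq_abs, mul_pow, Real.sq_sqrt hpos.le]
  ring

theorem norm_weightedCoeff_mono {d l m : ℕ} (h : l ≤ m) (u : Sobolev d l) (w : Sobolev d m)
    (huw : toL2 u = toL2 w) : ‖weightedCoeff u‖ ≤ ‖weightedCoeff w‖ := by
  refine le_of_sq_le_sq ?_ (norm_nonneg _)
  refine hasSum_le (fun n => ?_) (norm_weightedCoeff_sq u) (norm_weightedCoeff_sq w)
  by_cases hn : n = 0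
  · subst hn
    simp [torusCoeff_toL2_zero]
  · rw [huw]
    have := pow_le_pow_right₀ (one_le_freq hn) (Nat.mul_le_mul_left 2 h)
    have := Real.pi_pos
    gcongr

theorem norm_toL2_le_weightedCoeff {d k : ℕ} (u : Sobolev d k) : ‖toL2 u‖ ≤ ‖weightedCoeff u‖ := by
  have hpos : (0 : ℝ) < (2 * Real.pi) ^ d := pow_pos Real.two_pi_pos d
  refine le_of_sq_le_sq ?_ (norm_nonneg _)
  refine hasSum_le (fun n => ?_) (parseval (toL2 u)) (norm_weightedCoeff_sq u)
  by_cases hn : n = 0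
  · subst hn
    simp [torusCoeff_toL2_zero]
  · exact mul_le_mul_of_nonneg_left
      (le_mul_of_one_le_left (sq_nonneg _) (one_le_pow₀ (one_le_freq hn))) hpos.le

theorem weightedCoeff_injective {d k : ℕ} :
    Function.Injective (weightedCoeff : Sobolev d k → lp (fun _ : Fin d → ℤ => ℂ) 2) := by
  rw [← LinearMap.ker_eq_bot, LinearMap.ker_eq_bot']
  intro u hu
  have h := norm_toL2_le_weightedCoeff u
  rw [hu, norm_zero] at h
  exact toL2_injective (by simpa using norm_le_zero_iff.1 h)

theorem mem_of_le {d l m : ℕ} (h : l ≤ m) (u : Sobolev d m) : toL2 u ∈ sobolevSubmodule d l := by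
  refine ⟨(toL2_mem u).1, Summable.of_nonneg_of_le
    (fun n => mul_nonneg (pow_nonneg (Real.sqrt_nonneg _) _) (sq_nonneg _))
    (fun n => ?_) (toL2_mem u).2⟩
  by_cases hn : n = 0
  · subst hn
    simp [torusCoeff_toL2_zero]
  · have := pow_le_pow_right₀ (one_le_freq hn) (Nat.mul_le_mul_left 2 h)
    gcongr

/-- An element of `H^m`, seen as an element of `H^l`, where `l ≤ m`. -/
def lower {d l m : ℕ} (h : l ≤ m) (u : Sobolev d m) : Sobolev d l := mk (toL2 u) (mem_of_le h u)

theorem toL2_lower {d l m : ℕ} (h : l ≤ m) (u : Sobolev d m) : toL2 (lower h u) = toL2 u :=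
  toL2_mk _ _

/-- The linear map `lower`. -/
def inclₗ {d l m : ℕ} (h : l ≤ m) : Sobolev d m →ₗ[ℝ] Sobolev d l where
  toFun := lower h
  map_add' u w := toL2_injective (by rw [map_add, toL2_lower, toL2_lower, toL2_lower, map_add])
  map_smul' c u := toL2_injective (by
    rw [map_smul, toL2_lower, toL2_lower, map_smul, RingHom.id_apply])

theorem toL2_inclₗ {d l m : ℕ} (h : l ≤ m) (u : Sobolev d m) : toL2 (inclₗ h u) = toL2 u :=
  toL2_lower h u

/-- The norm `‖u‖_k = ‖(-Δ)^{k/2} u‖_{L²}` of `H^k`, that is,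
`‖u‖_k² = (2π)^d ∑ |n|^{2k} |û(n)|²`. -/
instance {d k : ℕ} : NormedAddCommGroup (Sobolev d k) :=
  NormedAddCommGroup.induced (Sobolev d k) (lp (fun _ : Fin d → ℤ => ℂ) 2)
    (weightedCoeff (d := d) (k := k)) weightedCoeff_injective

instance {d k : ℕ} : NormedSpace ℝ (Sobolev d k) :=
  NormedSpace.induced ℝ (Sobolev d k) (lp (fun _ : Fin d → ℤ => ℂ) 2)
    (weightedCoeff (d := d) (k := k))

theorem norm_eq {d k : ℕ} (u : Sobolev d k) : ‖u‖ = ‖weightedCoeff u‖ := rfl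

theorem norm_sq {d k : ℕ} (u : Sobolev d k) :
    ‖u‖ ^ 2 = (2 * Real.pi) ^ d * ∑' n, freq n ^ (2 * k) * ‖torusCoeff (toL2 u) n‖ ^ 2 := by
  rw [norm_eq, ← tsum_mul_left, (norm_weightedCoeff_sq u).tsum_eq]

/-- The inclusion `H^m ⊆ H^l` for `l ≤ m`. -/
def incl {d l m : ℕ} (h : l ≤ m) : Sobolev d m →L[ℝ] Sobolev d l :=
  LinearMap.mkContinuous (inclₗ h) 1 (fun u => by
    rw [one_mul]
    exact norm_weightedCoeff_mono h _ u (toL2_inclₗ h u))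

theorem incl_apply {d l m : ℕ} (h : l ≤ m) (u : Sobolev d m) : incl h u = inclₗ h u := by
  rw [incl, LinearMap.mkContinuous_apply]

theorem toL2_incl {d l m : ℕ} (h : l ≤ m) (u : Sobolev d m) : toL2 (incl h u) = toL2 u := by
  rw [incl_apply, toL2_inclₗ]

theorem continuous_torusCoeff {d : ℕ} (n : Fin d → ℤ) :
    Continuous (fun u : L2 d => torusCoeff u n) := by
  let L : L2 d →ₗ[ℝ] ℂ :=
    { toFun := fun u => torusCoeff u n
      map_add' := fun u w => torusCoeff_add u w n
      map_smul' := fun c u => torusCoeff_smul c u n }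
  have hpos : (0 : ℝ) < (2 * Real.pi) ^ d := pow_pos Real.two_pi_pos d
  have h1 : (1 : ℝ) ≤ (2 * Real.pi) ^ d :=
    one_le_pow₀ (by linarith [Real.pi_gt_three])
  refine (LinearMap.mkContinuous L 1 fun u => ?_).continuous
  rw [one_mul]
  refine le_of_sq_le_sq ?_ (norm_nonneg _)
  refine le_trans ?_ (le_hasSum (parseval u) n fun _ _ => by positivity)
  exact le_mul_of_one_le_left (sq_nonneg _) h1

theorem isometry_weightedCoeff {d k : ℕ} :
    Isometry (weightedCoeff : Sobolev d k → lp (fun _ : Fin d → ℤ => ℂ) 2) :=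
  AddMonoidHomClass.isometry_of_norm _ fun _ => rfl

instance {d k : ℕ} : CompleteSpace (Sobolev d k) := by
  refine Metric.complete_of_cauchySeq_tendsto fun s hs => ?_
  have hW : CauchySeq (fun i => weightedCoeff (s i)) :=
    isometry_weightedCoeff.uniformContinuous.comp_cauchySeq hs
  obtain ⟨a, ha⟩ := cauchySeq_tendsto_of_complete hW
  let e : Sobolev d k →L[ℝ] L2 d :=
    LinearMap.mkContinuous toL2 1 fun u => by rw [one_mul]; exact norm_toL2_le_weightedCoeff u
  have hL : CauchySeq (fun i => toL2 (s i)) := e.uniformContinuous.comp_cauchySeq hs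
  obtain ⟨u, hu⟩ := cauchySeq_tendsto_of_complete hL
  have hcoef : ∀ n, (a : (Fin d → ℤ) → ℂ) n =
      ((Real.sqrt ((2 * Real.pi) ^ d) * freq n ^ k : ℝ) : ℂ) * torusCoeff u n := by
    intro n
    have h1 : Filter.Tendsto (fun i => (weightedCoeff (s i) : (Fin d → ℤ) → ℂ) n) Filter.atTop
        (nhds ((a : (Fin d → ℤ) → ℂ) n)) :=
      ((continuous_apply n).comp (lp.uniformContinuous_coe.continuous)).continuousAt.tendsto.comp ha
    have h2 := (((continuous_torusCoeff n).tendsto u).comp hu).const_mul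
      ((Real.sqrt ((2 * Real.pi) ^ d) * freq n ^ k : ℝ) : ℂ)
    exact tendsto_nhds_unique h1 h2
  have hmean : ∫ x, u x = 0 := by
    have h0 : torusCoeff u 0 = 0 := by
      have h2 := ((continuous_torusCoeff (0 : Fin d → ℤ)).tendsto u).comp hu
      refine tendsto_nhds_unique h2 ?_
      simp [Function.comp_def, torusCoeff_toL2_zero]
    rw [torusCoeff, neg_zero, character_zero] at h0
    simp only [ContinuousMap.one_apply, one_mul] at h0
    rw [integral_complex_ofReal, mul_eq_zero, inv_eq_zero, Complex.ofReal_eq_zero,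
      Complex.ofReal_eq_zero] at h0
    exact h0.resolve_left (pow_pos Real.two_pi_pos d).ne'
  have hsum : Summable fun n => freq n ^ (2 * k) * ‖torusCoeff u n‖ ^ 2 := by
    rw [← memlp_iff]
    convert lp.memℓp a using 1
    ext n
    exact (hcoef n).symm
  let w : Sobolev d k := mk u ⟨hmean, hsum⟩
  have hw : weightedCoeff w = a := by
    ext n
    exact (hcoef n).symm
  exact ⟨w, isometry_weightedCoeff.isEmbedding.tendsto_nhds_iff.2 (by rw [hw]; exact ha)⟩

end Sobolev

/-- The space `H^k(𝕋^d; ℝ^d)` of vector fields `v = (v_1, …, v_d)` with components in `H^k` and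
`‖v‖² = ∑ j, ‖v_j‖_k²`. -/
abbrev VecSobolev (d k : ℕ) : Type := PiLp 2 fun _ : Fin d => Sobolev d k

/-- The closed subspace `H^k_σ` of the divergence-free vector fields in `H^k(𝕋^d; ℝ^d)`: the
distribution `div v = ∑ j, ∂_j v_j` vanishes, all its Fourier coefficients being zero. -/
def SobolevSigma (d k : ℕ) : Submodule ℝ (VecSobolev d k) where
  carrier := {v | ∀ n : Fin d → ℤ, ∑ j, I * (n j : ℂ) * torusCoeff (v j).toL2 n = 0}
  zero_mem' n := by
    simp only [PiLp.zero_apply, map_zero, torusCoeff_zero, mul_zero, Finset.sum_const_zero]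
  add_mem' {v w} hv hw n := by
    simp only [PiLp.add_apply, map_add, torusCoeff_add, mul_add, Finset.sum_add_distrib, hv n, hw n,
      add_zero]
  smul_mem' c v hv n := by
    simp only [PiLp.smul_apply, map_smul, torusCoeff_smul, mul_left_comm _ (c : ℂ),
      ← Finset.mul_sum, hv n, mul_zero]

/-- A field of `H^m_σ`, seen as an element of `H^l(𝕋^d; ℝ^d)`, where `l ≤ m`. -/
def SobolevSigma.toVec {d l m : ℕ} (h : l ≤ m) (v : SobolevSigma d m) : VecSobolev d l :=
  WithLp.toLp 2 fun j => Sobolev.incl h ((v : VecSobolev d m) j)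

/-- The function `g ∈ L²(𝕋^d)` is the `j`-th partial derivative of `u ∈ L²(𝕋^d)` in the sense of
distributions: `∫ g e^{-in·x} dx = -∫ u ∂_j e^{-in·x} dx` for every `n`, that is,
`ĝ(n) = i n_j û(n)`. -/
def IsPartialDeriv {d : ℕ} (j : Fin d) (u g : L2 d) : Prop :=
  ∀ n : Fin d → ℤ, torusCoeff g n = I * (n j : ℂ) * torusCoeff u n

/-- The time interval `J_T = [0, T]`. -/
abbrev TimeInterval (T : ℝ) : Type := Set.Icc (0 : ℝ) T

/-- The Lebesgue measure on `J_T`. -/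
def timeMeasure (T : ℝ) : Measure (TimeInterval T) := (volume : Measure ℝ).comap Subtype.val

/-- The relaxation norm `|||v|||_{T,X} = sup_{t ∈ J_T} ‖∫_0^t v(s) ds‖_X`. -/
def relaxationNorm {X : Type*} [NormedAddCommGroup X] [NormedSpace ℝ X] {T : ℝ}
    (v : TimeInterval T → X) : ℝ :=
  ⨆ t : TimeInterval T, ‖∫ s in Set.Iic t, v s ∂(timeMeasure T)‖

/-- The function `u : J_T → X` is in `H¹(J_T; X)` with `∂u/∂t = w`: it is a primitive of the square
integrable function `w`. -/
def HasTimeDeriv {X : Type*} [NormedAddCommGroup X] [NormedSpace ℝ X] {T : ℝ}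
    (u w : TimeInterval T → X) : Prop :=
  MemLp w 2 (timeMeasure T) ∧
    ∀ s t : TimeInterval T, s ≤ t → u t - u s = ∫ r in Set.Ioc s t, w r ∂(timeMeasure T)

/-- `φ ∈ C(J_T; H^m)` seen as an element of `C(J_T; H^l)`, where `l ≤ m`. -/
def inclC {d l m : ℕ} (h : l ≤ m) {T : ℝ} (φ : C(TimeInterval T, Sobolev d m)) :
    C(TimeInterval T, Sobolev d l) where
  toFun t := Sobolev.incl h (φ t)
  continuous_toFun := (Sobolev.incl h).continuous.comp φ.continuous

/-- The equation `ψ + v · ∇φ - Δφ = 0` almost everywhere on `𝕋^d`. Here `G j = ∂_j φ` and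
`S j = ∂_j ∂_j φ`; these functions of `L²(𝕋^d)` are determined by `φ`. -/
def AdvectionDiffusionAt {d : ℕ} (v : Fin d → L2 d) (φ ψ : L2 d) : Prop :=
  ∃ G S : Fin d → L2 d,
    (∀ j, IsPartialDeriv j φ (G j)) ∧ (∀ j, IsPartialDeriv j (G j) (S j)) ∧
    ∀ᵐ x, ψ x + ∑ j, v j x * G j x - ∑ j, S j x = 0

/-- `φ ∈ C(J_T; H^{k+2}) ∩ L²(J_T; H^{k+3}) ∩ H¹(J_T; H^{k+1})` is a solution of
`∂φ/∂t + v · ∇φ - Δφ = 0` on `J_T × 𝕋^d` with `φ(0) = f`. -/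
structure IsSolution {d k : ℕ} {T : ℝ} (hT : 0 ≤ T)
    (v : C(TimeInterval T, SobolevSigma d (k + 2))) (f : Sobolev d (k + 2))
    (φ : C(TimeInterval T, Sobolev d (k + 2))) : Prop where
  initial : φ ⟨0, le_rfl, hT⟩ = f
  memL2 : ∃ w : TimeInterval T → Sobolev d (k + 3), MemLp w 2 (timeMeasure T) ∧
    ∀ᵐ t ∂(timeMeasure T), (w t).toL2 = (φ t).toL2
  equation : ∃ ψ : TimeInterval T → Sobolev d (k + 1),
    HasTimeDeriv (inclC (Nat.le_succ (k + 1)) φ) ψ ∧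
    ∀ᵐ t ∂(timeMeasure T),
      AdvectionDiffusionAt (fun j => ((v t : VecSobolev d (k + 2)) j).toL2) (φ t).toL2 (ψ t).toL2

end AdvDiff

end

open AdvDiff

/-!
The Fourier coefficients of a solution `φ` satisfy `φ̂(n)' = -|n|² φ̂(n) - (v · ∇φ)^(n)`, and the
right-hand side is continuous in time, so that all estimates can be made on Fourier coefficients
with classical derivatives and finite sums over frequencies.

Two tools carry the argument. The algebra property of `H^m` for `m > d/2` (`SobolevBound.conv`) gives
`‖v · ∇a‖_m ≤ C ‖v‖_{m+1} ‖a‖_{m+1}` (`SobolevBound.adv`, where the advection term is written as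
`div (a v)`) and `‖v · ∇a‖_m ≤ C ‖v‖_m ‖a‖_{m+1}` (`SobolevBound.adv_of_divFree`). The energy estimate
for the heat equation (`SobolevBound.of_heat`) gains one derivative: if `y' = Δy + h`, then
`‖y(t)‖²_{m+1} ≤ ‖y(0)‖²_{m+1} + ½ ∫ ‖h‖²_m`. With Grönwall's inequality they bound the solutions in
`H^{k+2}` (`IsSolution.norm_sq_le`).

Let `w = φ₁ - φ₂`, `v = v₁ - v₂` and `V(t) = ∫_0^t v`. The function `z = w + V · ∇φ₂` solves
`z' = Δz - Δ(V · ∇φ₂) - v₁ · ∇w + V · ∇φ₂'`, in which `v` only occurs through `V`. Estimated in `H^k`,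
the terms with `V` are of the size of `‖V‖_{k+1}`, because `φ₂` is bounded in `H^{k+2}` and
`φ₂'` is bounded in `H^k`. As `V` is bounded in `H^{k+2}`, interpolation gives
`‖V‖²_{k+1} ≤ ‖V‖_k ‖V‖_{k+2} ≤ C |||v|||_{T,k}`: this is the square root in the theorem. Grönwall's
inequality for `‖w‖²_k` concludes.
-/

noncomputable section

namespace AdvDiff

open MeasureTheory Complex

/-! ### Square summable weights and convolution of Fourier coefficients -/

theorem freq_eq_norm {d : ℕ} (n : Fin d → ℤ) :
    freq n = ‖(WithLp.toLp 2 fun j => (n j : ℝ) : EuclideanSpace ℝ (Fin d))‖ := by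
  rw [EuclideanSpace.norm_eq, freq]
  simp

theorem freq_nonneg {d : ℕ} (n : Fin d → ℤ) : 0 ≤ freq n := Real.sqrt_nonneg _

theorem freq_zero {d : ℕ} : freq (0 : Fin d → ℤ) = 0 := by simp [freq]

theorem freq_add_le {d : ℕ} (m n : Fin d → ℤ) : freq (m + n) ≤ freq m + freq n := by
  rw [freq_eq_norm, freq_eq_norm, freq_eq_norm]
  refine le_trans (le_of_eq ?_) (norm_add_le _ _)
  congr 1
  ext j
  simp

theorem sq_freq {d : ℕ} (n : Fin d → ℤ) : freq n ^ 2 = ∑ j, (n j : ℝ) ^ 2 :=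
  Real.sq_sqrt (Finset.sum_nonneg fun _ _ => sq_nonneg _)

theorem abs_le_freq {d : ℕ} (n : Fin d → ℤ) (j : Fin d) : |(n j : ℝ)| ≤ freq n := by
  rw [freq, ← Real.sqrt_sq_eq_abs]
  exact Real.sqrt_le_sqrt (Finset.single_le_sum (f := fun j => (n j : ℝ) ^ 2)
    (fun j _ => sq_nonneg _) (Finset.mem_univ j))

theorem summable_inv_freq_pow {d m : ℕ} (hm : d < 2 * m) :
    Summable fun l : Fin d → ℤ => (freq l)⁻¹ ^ (2 * m) := by
  let b := (EuclideanSpace.basisFun (Fin d) ℝ).toBasis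
  let L : Submodule ℤ (EuclideanSpace ℝ (Fin d)) := Submodule.span ℤ (Set.range b)
  have hr : Module.finrank ℤ L = d := by
    rw [ZLattice.rank ℝ L]
    simp
  have hs := ZLattice.summable_norm_pow_inv L (2 * m) (by rw [hr]; exact hm)
  let e : (Fin d → ℤ) → L := fun n => ⟨WithLp.toLp 2 fun j => (n j : ℝ), by
    rw [show (WithLp.toLp 2 fun j => (n j : ℝ) : EuclideanSpace ℝ (Fin d)) = ∑ j, n j • b j by
      ext i
      simp [b, Finset.sum_apply, Pi.single_apply]]
    exact Submodule.sum_mem _ fun j _ =>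
      Submodule.smul_mem _ _ (Submodule.subset_span (Set.mem_range_self j))⟩
  have he : Function.Injective e := by
    intro m n h
    have h1 := congrArg WithLp.ofLp (congrArg Subtype.val h)
    funext j
    have h2 := congrFun h1 j
    simpa [e] using h2
  refine (hs.comp_injective he).congr fun n => ?_
  simp only [Function.comp_apply, e, freq_eq_norm]
  rfl

/-- The bound `∑ |n|^{2m} |a n|² ≤ A` on a family of Fourier coefficients, stated for all finite
partial sums. -/
def SobolevBound {d : ℕ} (m : ℕ) (a : (Fin d → ℤ) → ℂ) (A : ℝ) : Prop :=
  ∀ F : Finset (Fin d → ℤ), ∑ n ∈ F, freq n ^ (2 * m) * ‖a n‖ ^ 2 ≤ A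

namespace SobolevBound

variable {d m : ℕ} {a b : (Fin d → ℤ) → ℂ} {A B : ℝ}

theorem nonneg (h : SobolevBound m a A) : 0 ≤ A := by simpa using h ∅

theorem mono (h : SobolevBound m a A) (hAB : A ≤ B) : SobolevBound m a B :=
  fun F => (h F).trans hAB

theorem of_le {l : ℕ} (hl : l ≤ m) (h0 : a 0 = 0) (h : SobolevBound m a A) :
    SobolevBound l a A := by
  refine fun F => (Finset.sum_le_sum fun n _ => ?_).trans (h F)
  by_cases hn : n = 0
  · simp [hn, h0]
  · have := pow_le_pow_right₀ (one_le_freq hn) (Nat.mul_le_mul_left 2 hl)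
    gcongr

theorem norm_le (h : SobolevBound m a A) (h0 : a 0 = 0) (n : Fin d → ℤ) :
    ‖a n‖ ≤ Real.sqrt A * (freq n)⁻¹ ^ m := by
  by_cases hn : n = 0
  · rw [hn, h0, norm_zero]
    exact mul_nonneg (Real.sqrt_nonneg _) (pow_nonneg (inv_nonneg.2 (freq_nonneg _)) _)
  · have h1 : 0 < freq n := lt_of_lt_of_le one_pos (one_le_freq hn)
    have h2 := h {n}
    rw [Finset.sum_singleton, pow_mul', ← mul_pow] at h2
    rw [inv_pow, ← div_eq_mul_inv, le_div_iff₀ (by positivity), mul_comm]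
    exact Real.le_sqrt_of_sq_le h2

theorem add (ha : SobolevBound m a A) (hb : SobolevBound m b B) :
    SobolevBound m (a + b) (2 * A + 2 * B) := by
  intro F
  have := ha F
  have := hb F
  refine le_trans (Finset.sum_le_sum (g := fun n => 2 * (freq n ^ (2 * m) * ‖a n‖ ^ 2) +
    2 * (freq n ^ (2 * m) * ‖b n‖ ^ 2)) fun n _ => ?_) ?_
  · have h1 : ‖(a + b) n‖ ^ 2 ≤ 2 * ‖a n‖ ^ 2 + 2 * ‖b n‖ ^ 2 := by
      have : ‖(a + b) n‖ ≤ ‖a n‖ + ‖b n‖ := norm_add_le _ _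
      nlinarith [norm_nonneg ((a + b) n), sq_nonneg (‖a n‖ - ‖b n‖)]
    have h2 : 0 ≤ freq n ^ (2 * m) := pow_nonneg (freq_nonneg _) _
    nlinarith
  · rw [Finset.sum_add_distrib, ← Finset.mul_sum, ← Finset.mul_sum]
    linarith

theorem neg (ha : SobolevBound m a A) : SobolevBound m (-a) A := by
  intro F
  simpa using ha F

/-- Differentiation in the sense of a multiplier of size at most `|n|` costs one derivative. -/
theorem of_norm_le_freq_mul (ha : SobolevBound (m + 1) a A) (h : ∀ n, ‖b n‖ ≤ freq n * ‖a n‖) :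
    SobolevBound m b A := by
  refine fun F => (Finset.sum_le_sum fun n _ => ?_).trans (ha F)
  have h1 : ‖b n‖ ^ 2 ≤ (freq n * ‖a n‖) ^ 2 := pow_le_pow_left₀ (norm_nonneg _) (h n) 2
  have h2 : 0 ≤ freq n ^ (2 * m) := pow_nonneg (freq_nonneg _) _
  calc freq n ^ (2 * m) * ‖b n‖ ^ 2 ≤ freq n ^ (2 * m) * (freq n * ‖a n‖) ^ 2 := by gcongr
    _ = _ := by ring

theorem sum {ι : Type*} [Fintype ι] {c : ι → (Fin d → ℤ) → ℂ} (h : ∀ i, SobolevBound m (c i) A) :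
    SobolevBound m (fun n => ∑ i, c i n) (Fintype.card ι ^ 2 * A) := by
  intro F
  have h1 : ∀ n, freq n ^ (2 * m) * ‖∑ i, c i n‖ ^ 2 ≤
      ∑ i, Fintype.card ι * (freq n ^ (2 * m) * ‖c i n‖ ^ 2) := by
    intro n
    have h2 : ‖∑ i, c i n‖ ^ 2 ≤ Fintype.card ι * ∑ i, ‖c i n‖ ^ 2 := by
      refine le_trans (pow_le_pow_left₀ (norm_nonneg _) (norm_sum_le _ _) 2) ?_
      simpa using sq_sum_le_card_mul_sum_sq (s := Finset.univ) (f := fun i => ‖c i n‖)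
    have h3 : 0 ≤ freq n ^ (2 * m) := pow_nonneg (freq_nonneg _) _
    calc _ ≤ freq n ^ (2 * m) * (Fintype.card ι * ∑ i, ‖c i n‖ ^ 2) := by gcongr
      _ = _ := by simp only [Finset.mul_sum]; exact Finset.sum_congr rfl fun i _ => by ring
  refine (Finset.sum_le_sum fun n _ => h1 n).trans ?_
  rw [Finset.sum_comm]
  calc _ ≤ ∑ i : ι, Fintype.card ι * A := by
        refine Finset.sum_le_sum fun i _ => ?_
        rw [← Finset.mul_sum]
        exact mul_le_mul_of_nonneg_left (h i F) (Nat.cast_nonneg _)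
    _ = _ := by simp; ring

end SobolevBound

/-- The convolution of two families of Fourier coefficients. -/
def conv {d : ℕ} (a b : (Fin d → ℤ) → ℂ) (n : Fin d → ℤ) : ℂ := ∑' l, a (n - l) * b l

/-- Up to constants, this dominates the terms of the convolution of two families of size
`|l|^{-m}`. -/
def convMajorant {d : ℕ} (m : ℕ) (n l : Fin d → ℤ) : ℝ :=
  (freq (n - l))⁻¹ ^ (2 * m) + (freq l)⁻¹ ^ (2 * m)

theorem hasSum_convMajorant {d m : ℕ} (hm : d < 2 * m) (n : Fin d → ℤ) :
    HasSum (convMajorant m n) (2 * ∑' l : Fin d → ℤ, (freq l)⁻¹ ^ (2 * m)) := by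
  have h := (summable_inv_freq_pow hm).hasSum
  rw [two_mul]
  exact ((Equiv.subLeft n).hasSum_iff.2 h).add h

theorem convMajorant_nonneg {d m : ℕ} (n l : Fin d → ℤ) : 0 ≤ convMajorant m n l :=
  add_nonneg (pow_nonneg (inv_nonneg.2 (freq_nonneg _)) _)
    (pow_nonneg (inv_nonneg.2 (freq_nonneg _)) _)

theorem norm_conv_term_le {d m : ℕ} {a b : (Fin d → ℤ) → ℂ} {A B : ℝ}
    (ha : ∀ l, ‖a l‖ ≤ A * (freq l)⁻¹ ^ m) (hb : ∀ l, ‖b l‖ ≤ B * (freq l)⁻¹ ^ m)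
    (hA : 0 ≤ A) (hB : 0 ≤ B) (n l : Fin d → ℤ) :
    ‖a (n - l) * b l‖ ≤ A * B * convMajorant m n l := by
  have hx : 0 ≤ (freq (n - l))⁻¹ ^ m := pow_nonneg (inv_nonneg.2 (freq_nonneg _)) _
  have hy : 0 ≤ (freq l)⁻¹ ^ m := pow_nonneg (inv_nonneg.2 (freq_nonneg _)) _
  rw [norm_mul]
  calc _ ≤ (A * (freq (n - l))⁻¹ ^ m) * (B * (freq l)⁻¹ ^ m) := by gcongr; exacts [ha _, hb _]
    _ = A * B * ((freq (n - l))⁻¹ ^ m * (freq l)⁻¹ ^ m) := by ring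
    _ ≤ A * B * convMajorant m n l := by
      refine mul_le_mul_of_nonneg_left ?_ (mul_nonneg hA hB)
      rw [convMajorant, pow_mul', pow_mul']
      nlinarith [sq_nonneg ((freq (n - l))⁻¹ ^ m - (freq l)⁻¹ ^ m)]

theorem summable_conv {d m : ℕ} (hm : d < 2 * m) {a b : (Fin d → ℤ) → ℂ} {A B : ℝ}
    (ha : SobolevBound m a A) (hb : SobolevBound m b B) (ha0 : a 0 = 0) (hb0 : b 0 = 0)
    (n : Fin d → ℤ) : Summable fun l => a (n - l) * b l :=
  Summable.of_norm_bounded ((hasSum_convMajorant hm n).summable.mul_left _)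
    (norm_conv_term_le (ha.norm_le ha0) (hb.norm_le hb0) (Real.sqrt_nonneg _)
      (Real.sqrt_nonneg _) n)

theorem continuousOn_conv {d m : ℕ} (hm : d < 2 * m) {X : Type*} [TopologicalSpace X] {s : Set X}
    {a b : X → (Fin d → ℤ) → ℂ} {A B : ℝ}
    (ha : ∀ t ∈ s, SobolevBound m (a t) A) (hb : ∀ t ∈ s, SobolevBound m (b t) B)
    (ha0 : ∀ t ∈ s, a t 0 = 0) (hb0 : ∀ t ∈ s, b t 0 = 0)
    (hac : ∀ l, ContinuousOn (fun t => a t l) s) (hbc : ∀ l, ContinuousOn (fun t => b t l) s)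
    (n : Fin d → ℤ) : ContinuousOn (fun t => conv (a t) (b t) n) s :=
  continuousOn_tsum (fun l => (hac _).mul (hbc l))
    ((hasSum_convMajorant hm n).summable.mul_left (Real.sqrt A * Real.sqrt B))
    (fun l t ht => norm_conv_term_le ((ha t ht).norm_le (ha0 t ht)) ((hb t ht).norm_le (hb0 t ht))
      (Real.sqrt_nonneg _) (Real.sqrt_nonneg _) n l)

theorem conv_add_left {d m : ℕ} (hm : d < 2 * m) {a a' b : (Fin d → ℤ) → ℂ} {A A' B : ℝ}
    (ha : SobolevBound m a A) (ha' : SobolevBound m a' A') (hb : SobolevBound m b B)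
    (ha0 : a 0 = 0) (ha0' : a' 0 = 0) (hb0 : b 0 = 0) (n : Fin d → ℤ) :
    conv (a + a') b n = conv a b n + conv a' b n := by
  rw [conv, conv, conv, ← (summable_conv hm ha hb ha0 hb0 n).tsum_add
    (summable_conv hm ha' hb ha0' hb0 n)]
  exact tsum_congr fun l => by simp [add_mul]

theorem conv_comm {d : ℕ} (a b : (Fin d → ℤ) → ℂ) (n : Fin d → ℤ) : conv a b n = conv b a n := by
  rw [conv, ← (Equiv.subLeft n).tsum_eq, conv]
  exact tsum_congr fun l => by simp [mul_comm]

theorem conv_add_right {d m : ℕ} (hm : d < 2 * m) {a b b' : (Fin d → ℤ) → ℂ} {A B B' : ℝ}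
    (ha : SobolevBound m a A) (hb : SobolevBound m b B) (hb' : SobolevBound m b' B')
    (ha0 : a 0 = 0) (hb0 : b 0 = 0) (hb0' : b' 0 = 0) (n : Fin d → ℤ) :
    conv a (b + b') n = conv a b n + conv a b' n := by
  rw [conv_comm, conv_add_left hm hb hb' ha hb0 hb0' ha0, conv_comm b, conv_comm b']

theorem hasDerivAt_conv {d m : ℕ} (hm : d < 2 * m) {s : Set ℝ} (hs : IsOpen s)
    (hs' : IsPreconnected s) {a b a' b' : ℝ → (Fin d → ℤ) → ℂ} {A B A' B' : ℝ}
    (ha : ∀ t ∈ s, SobolevBound m (a t) A) (hb : ∀ t ∈ s, SobolevBound m (b t) B)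
    (ha' : ∀ t ∈ s, SobolevBound m (a' t) A') (hb' : ∀ t ∈ s, SobolevBound m (b' t) B')
    (ha0 : ∀ t ∈ s, a t 0 = 0) (hb0 : ∀ t ∈ s, b t 0 = 0)
    (ha0' : ∀ t ∈ s, a' t 0 = 0) (hb0' : ∀ t ∈ s, b' t 0 = 0)
    (hda : ∀ l, ∀ t ∈ s, HasDerivAt (fun t => a t l) (a' t l) t)
    (hdb : ∀ l, ∀ t ∈ s, HasDerivAt (fun t => b t l) (b' t l) t)
    (n : Fin d → ℤ) {t : ℝ} (ht : t ∈ s) :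
    HasDerivAt (fun t => conv (a t) (b t) n) (conv (a' t) (b t) n + conv (a t) (b' t) n) t := by
  have hsum := (hasSum_convMajorant hm n).summable
  rw [conv, conv, ← (summable_conv hm (ha' t ht) (hb t ht) (ha0' t ht) (hb0 t ht) n).tsum_add
    (summable_conv hm (ha t ht) (hb' t ht) (ha0 t ht) (hb0' t ht) n)]
  refine hasDerivAt_tsum_of_isPreconnected
    (g := fun l t => a t (n - l) * b t l)
    (g' := fun l t => a' t (n - l) * b t l + a t (n - l) * b' t l)
    ((hsum.mul_left (Real.sqrt A' * Real.sqrt B)).add (hsum.mul_left (Real.sqrt A * Real.sqrt B')))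
    hs hs' (fun l y hy => (hda _ y hy).mul (hdb l y hy)) (fun l y hy => ?_) ht
    (summable_conv hm (ha t ht) (hb t ht) (ha0 t ht) (hb0 t ht) n) ht
  refine (norm_add_le _ _).trans (add_le_add ?_ ?_)
  · exact norm_conv_term_le ((ha' y hy).norm_le (ha0' y hy)) ((hb y hy).norm_le (hb0 y hy))
      (Real.sqrt_nonneg _) (Real.sqrt_nonneg _) n l
  · exact norm_conv_term_le ((ha y hy).norm_le (ha0 y hy)) ((hb' y hy).norm_le (hb0' y hy))
      (Real.sqrt_nonneg _) (Real.sqrt_nonneg _) n l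

/-- The constant of the algebra property of `H^m`. -/
def convConst (d m : ℕ) : ℝ :=
  2 ^ (2 * m - 1) * (2 * ∑' l : Fin d → ℤ, (freq l)⁻¹ ^ (2 * m))

theorem convConst_nonneg (d m : ℕ) : 0 ≤ convConst d m :=
  mul_nonneg (by positivity) (mul_nonneg (by norm_num) (tsum_nonneg fun _ =>
    pow_nonneg (inv_nonneg.2 (freq_nonneg _)) _))

/-- Peetre's inequality `|n| / (|n - l| |l|) ≤ 1 / |n - l| + 1 / |l|`, to the power `2m`. -/
theorem freq_pow_mul_le_convMajorant {d m : ℕ} (hm : 0 < m) (n l : Fin d → ℤ) :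
    freq n ^ (2 * m) * ((freq (n - l))⁻¹ ^ m * (freq l)⁻¹ ^ m) ^ 2 ≤
      2 ^ (2 * m - 1) * convMajorant m n l := by
  have hpos := convMajorant_nonneg (m := m) n l
  by_cases hl : l = 0
  · simpa [hl, freq_zero, hm.ne'] using hl ▸ hpos
  by_cases hnl : n - l = 0
  · simpa [hnl, freq_zero, hm.ne'] using hpos
  have hx : 0 < freq (n - l) := lt_of_lt_of_le one_pos (one_le_freq hnl)
  have hy : 0 < freq l := lt_of_lt_of_le one_pos (one_le_freq hl)
  have hn : freq n ≤ freq (n - l) + freq l := by simpa using freq_add_le (n - l) l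
  rw [convMajorant]
  calc _ = (freq n * (freq (n - l))⁻¹ * (freq l)⁻¹) ^ (2 * m) := by
        rw [← mul_pow, ← pow_mul, mul_comm m 2, ← mul_pow, mul_assoc]
    _ ≤ ((freq (n - l) + freq l) * (freq (n - l))⁻¹ * (freq l)⁻¹) ^ (2 * m) := by
        have := freq_nonneg n
        gcongr
    _ = ((freq (n - l))⁻¹ + (freq l)⁻¹) ^ (2 * m) := by
        congr 1
        field_simp
        ring
    _ ≤ _ := add_pow_le (by positivity) (by positivity) _

/-- `H^m` is an algebra for `m > d/2`: a Cauchy–Schwarz inequality with weight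
`|n - l|^m |l|^m`. -/
theorem SobolevBound.conv {d m : ℕ} (hm : d < 2 * m) {a b : (Fin d → ℤ) → ℂ} {A B : ℝ}
    (ha : SobolevBound m a A) (hb : SobolevBound m b B) (ha0 : a 0 = 0) (hb0 : b 0 = 0) :
    SobolevBound m (conv a b) (convConst d m * (A * B)) := by
  intro F
  have hlim : Filter.Tendsto (fun G : Finset (Fin d → ℤ) => ∑ n ∈ F, freq n ^ (2 * m) *
      ‖∑ l ∈ G, a (n - l) * b l‖ ^ 2) Filter.atTop
      (nhds (∑ n ∈ F, freq n ^ (2 * m) * ‖AdvDiff.conv a b n‖ ^ 2)) :=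
    tendsto_finsetSum _ fun n _ =>
      (((summable_conv hm ha hb ha0 hb0 n).hasSum.norm.pow 2).const_mul _)
  -- It suffices to bound the partial sums over finite sets `G` of the convolution.
  refine le_of_tendsto' hlim fun G => ?_
  let p : (Fin d → ℤ) → (Fin d → ℤ) → ℝ := fun n l => (freq (n - l))⁻¹ ^ m * (freq l)⁻¹ ^ m
  let q : (Fin d → ℤ) → ℝ := fun l => freq l ^ m * ‖a l‖
  let r : (Fin d → ℤ) → ℝ := fun l => freq l ^ m * ‖b l‖
  -- At `l = 0` the weight is not invertible, but the coefficient vanishes.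
  have hcancel : ∀ (c : (Fin d → ℤ) → ℂ), c 0 = 0 → ∀ l,
      ‖c l‖ = (freq l)⁻¹ ^ m * (freq l ^ m * ‖c l‖) := by
    intro c hc l
    by_cases hl : l = 0
    · simp [hl, hc]
    · have : 0 < freq l := lt_of_lt_of_le one_pos (one_le_freq hl)
      rw [← mul_assoc, ← mul_pow, inv_mul_cancel₀ this.ne', one_pow, one_mul]
  have hterm : ∀ n, freq n ^ (2 * m) * ‖∑ l ∈ G, a (n - l) * b l‖ ^ 2 ≤
      convConst d m * ∑ l ∈ G, q (n - l) ^ 2 * r l ^ 2 := by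
    intro n
    have h1 : ‖∑ l ∈ G, a (n - l) * b l‖ ≤ ∑ l ∈ G, p n l * (q (n - l) * r l) := by
      refine (norm_sum_le _ _).trans (Finset.sum_le_sum fun l _ => le_of_eq ?_)
      rw [norm_mul, hcancel a ha0, hcancel b hb0]
      simp only [p, q, r]
      ring
    have h2 : ‖∑ l ∈ G, a (n - l) * b l‖ ^ 2 ≤
        (∑ l ∈ G, p n l ^ 2) * ∑ l ∈ G, (q (n - l) * r l) ^ 2 :=
      (pow_le_pow_left₀ (norm_nonneg _) h1 2).trans (Finset.sum_mul_sq_le_sq_mul_sq _ _ _)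
    have h3 : freq n ^ (2 * m) * ∑ l ∈ G, p n l ^ 2 ≤ convConst d m := by
      rw [Finset.mul_sum]
      refine (Finset.sum_le_sum fun l _ => freq_pow_mul_le_convMajorant (by omega) n l).trans ?_
      rw [← Finset.mul_sum, convConst]
      exact mul_le_mul_of_nonneg_left
        (sum_le_hasSum G (fun l _ => convMajorant_nonneg n l) (hasSum_convMajorant hm n))
        (by positivity)
    calc _ ≤ freq n ^ (2 * m) * ((∑ l ∈ G, p n l ^ 2) * ∑ l ∈ G, (q (n - l) * r l) ^ 2) :=
          mul_le_mul_of_nonneg_left h2 (pow_nonneg (freq_nonneg _) _)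
      _ = (freq n ^ (2 * m) * ∑ l ∈ G, p n l ^ 2) * ∑ l ∈ G, q (n - l) ^ 2 * r l ^ 2 := by
          simp only [mul_pow, mul_assoc]
      _ ≤ _ := mul_le_mul_of_nonneg_right h3
          (Finset.sum_nonneg fun l _ => mul_nonneg (sq_nonneg _) (sq_nonneg _))
  refine (Finset.sum_le_sum fun n _ => hterm n).trans ?_
  rw [← Finset.mul_sum]
  refine mul_le_mul_of_nonneg_left ?_ (convConst_nonneg d m)
  rw [Finset.sum_comm]
  have hq : ∀ l, ∑ n ∈ F, q (n - l) ^ 2 ≤ A := by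
    intro l
    have h1 := ha (F.map (Equiv.subRight l).toEmbedding)
    rw [Finset.sum_map] at h1
    refine le_trans (le_of_eq (Finset.sum_congr rfl fun n _ => ?_)) h1
    simp only [q, mul_pow, ← pow_mul, mul_comm m 2]
    rfl
  have hr : ∑ l ∈ G, r l ^ 2 ≤ B := by
    refine le_trans (le_of_eq (Finset.sum_congr rfl fun n _ => ?_)) (hb G)
    simp only [r, mul_pow, ← pow_mul, mul_comm m 2]
  calc _ = ∑ l ∈ G, (∑ n ∈ F, q (n - l) ^ 2) * r l ^ 2 := by simp only [Finset.sum_mul]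
    _ ≤ ∑ l ∈ G, A * r l ^ 2 :=
        Finset.sum_le_sum fun l _ => mul_le_mul_of_nonneg_right (hq l) (sq_nonneg _)
    _ = A * ∑ l ∈ G, r l ^ 2 := by rw [Finset.mul_sum]
    _ ≤ A * B := mul_le_mul_of_nonneg_left hr ha.nonneg

/-! ### Fourier coefficients of products and of the advection term -/

theorem integrable_character_mul_mul {d : ℕ} (u w : L2 d) (n : Fin d → ℤ) :
    Integrable (fun x => character n x * ((u x * w x : ℝ) : ℂ)) := by
  have hu : Integrable (fun x => ((u x * w x : ℝ) : ℂ)) (volume : Measure (Torus d)) :=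
    ((Lp.memLp u).integrable_mul (Lp.memLp w)).ofReal
  exact hu.bdd_mul (c := 1) (character n).continuous.aestronglyMeasurable
    (Filter.Eventually.of_forall fun x => (norm_character_apply n x).le)

/-- The Fourier coefficients of a product are the convolution of those of the factors: Parseval's
identity for `e^{in·x} u` and `w`. -/
theorem torusCoeff_mul {d : ℕ} (u w : L2 d) (n : Fin d → ℤ) :
    torusCoeff (fun x => u x * w x) n = conv (torusCoeff u) (torusCoeff w) n := by
  have hpos : (0 : ℝ) < (2 * Real.pi) ^ d := pow_pos Real.two_pi_pos d
  have hw : MemLp (fun x => ((w x : ℝ) : ℂ)) 2 (volume : Measure (Torus d)) :=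
    (Lp.memLp w).ofReal
  have hu' : MemLp (fun x => ((u x : ℝ) : ℂ)) 2 (volume : Measure (Torus d)) :=
    (Lp.memLp u).ofReal
  have hu : MemLp (fun x => character n x * ((u x : ℝ) : ℂ)) 2 (volume : Measure (Torus d)) :=
    hu'.of_le ((character n).continuous.aestronglyMeasurable.mul hu'.1)
      (Filter.Eventually.of_forall fun x => by
        rw [norm_mul, norm_character_apply, one_mul])
  set c : ℝ := Real.sqrt ((2 * Real.pi) ^ d) with hc
  have hc0 : (c : ℂ) ≠ 0 := by exact_mod_cast (Real.sqrt_pos.2 hpos).ne'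
  have hcc : (((2 * Real.pi) ^ d : ℝ) : ℂ) = (c : ℂ) * c := by
    rw [← Complex.ofReal_mul, hc, Real.mul_self_sqrt hpos.le]
  have hl : ∀ l, inner ℂ hu.toLp (charBasis d l) = (c : ℂ) * torusCoeff u (n - l) := by
    intro l
    rw [charBasis, HilbertBasis.coe_mk, L2.inner_def, torusCoeff, hcc, mul_inv, ← mul_assoc,
      mul_inv_cancel_left₀ hc0, ← integral_const_mul]
    apply integral_congr_ae
    filter_upwards [ContinuousMap.coeFn_toLp (p := 2) (𝕜 := ℂ)
      (volume : Measure (Torus d)) (normChar l), hu.coeFn_toLp] with x h1 h2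
    rw [h1, h2, RCLike.inner_apply, neg_sub, sub_eq_add_neg, character_add, character_neg]
    simp [normChar]
    ring
  have hr : ∀ l, inner ℂ (charBasis d l) hw.toLp = (c : ℂ) * torusCoeff w l := by
    intro l
    rw [charBasis, HilbertBasis.coe_mk, L2.inner_def, torusCoeff, hcc, mul_inv, ← mul_assoc,
      mul_inv_cancel_left₀ hc0, ← integral_const_mul]
    apply integral_congr_ae
    filter_upwards [ContinuousMap.coeFn_toLp (p := 2) (𝕜 := ℂ)
      (volume : Measure (Torus d)) (normChar l), hw.coeFn_toLp] with x h1 h2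
    rw [h1, h2, RCLike.inner_apply, character_neg]
    simp [normChar]
    ring
  have hs := (charBasis d).hasSum_inner_mul_inner hu.toLp hw.toLp
  have hi : inner ℂ hu.toLp hw.toLp = (c : ℂ) * c * torusCoeff (fun x => u x * w x) n := by
    rw [L2.inner_def, torusCoeff, hcc, mul_inv_cancel_left₀ (mul_ne_zero hc0 hc0)]
    apply integral_congr_ae
    filter_upwards [hu.coeFn_toLp, hw.coeFn_toLp] with x h1 h2
    rw [h1, h2, RCLike.inner_apply, character_neg]
    simp
    ring
  simp only [hl, hr, hi] at hs
  have hs' := hs.mul_left ((c : ℂ) * c)⁻¹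
  rw [inv_mul_cancel_left₀ (mul_ne_zero hc0 hc0)] at hs'
  rw [← hs'.tsum_eq, conv]
  refine tsum_congr fun l => ?_
  field_simp

/-- The Fourier coefficients of `∂_j u`. -/
def gradCoeff {d : ℕ} (j : Fin d) (a : (Fin d → ℤ) → ℂ) (n : Fin d → ℤ) : ℂ := I * (n j : ℂ) * a n

/-- The families of Fourier coefficients of a divergence-free field. -/
def DivFree {d : ℕ} (v : Fin d → (Fin d → ℤ) → ℂ) : Prop := ∀ n, ∑ j, (n j : ℂ) * v j n = 0

/-- The Fourier coefficients of the advection term in divergence form, `div (a v)`; this is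
`v · ∇a` for a divergence-free field `v`. -/
def adv {d : ℕ} (v : Fin d → (Fin d → ℤ) → ℂ) (a : (Fin d → ℤ) → ℂ) (n : Fin d → ℤ) : ℂ :=
  ∑ j, gradCoeff j (conv (v j) a) n

theorem norm_gradCoeff_le {d : ℕ} (j : Fin d) (a : (Fin d → ℤ) → ℂ) (n : Fin d → ℤ) :
    ‖gradCoeff j a n‖ ≤ freq n * ‖a n‖ := by
  rw [gradCoeff, norm_mul, norm_mul, Complex.norm_I, one_mul]
  refine mul_le_mul_of_nonneg_right ?_ (norm_nonneg _)
  simpa using abs_le_freq n j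

theorem gradCoeff_zero {d : ℕ} (j : Fin d) (a : (Fin d → ℤ) → ℂ) : gradCoeff j a 0 = 0 := by
  simp [gradCoeff]

theorem adv_zero {d : ℕ} (v : Fin d → (Fin d → ℤ) → ℂ) (a : (Fin d → ℤ) → ℂ) : adv v a 0 = 0 := by
  simp [adv, gradCoeff_zero]

theorem SobolevBound.gradCoeff {d m : ℕ} {a : (Fin d → ℤ) → ℂ} {A : ℝ}
    (ha : SobolevBound (m + 1) a A) (j : Fin d) : SobolevBound m (gradCoeff j a) A :=
  ha.of_norm_le_freq_mul (norm_gradCoeff_le j a)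

theorem adv_eq_sum_conv {d m : ℕ} (hm : d < 2 * m) {v : Fin d → (Fin d → ℤ) → ℂ}
    {a : (Fin d → ℤ) → ℂ} {A B : ℝ} (hv : ∀ j, SobolevBound m (v j) A)
    (ha : SobolevBound (m + 1) a B) (hv0 : ∀ j, v j 0 = 0) (ha0 : a 0 = 0) (hdiv : DivFree v)
    (n : Fin d → ℤ) : adv v a n = ∑ j, conv (v j) (gradCoeff j a) n := by
  have h1 : ∀ j, Summable fun l => v j (n - l) * a l := fun j =>
    summable_conv hm (hv j) (ha.of_le (Nat.le_succ m) ha0) (hv0 j) ha0 n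
  have h2 : ∀ j, Summable fun l => v j (n - l) * gradCoeff j a l := fun j =>
    summable_conv hm (hv j) (ha.gradCoeff j) (hv0 j) (gradCoeff_zero j a) n
  simp only [adv, conv, gradCoeff, ← tsum_mul_left]
  simp only [gradCoeff] at h2
  rw [← Summable.tsum_finsetSum fun j _ => (h1 j).mul_left _,
    ← Summable.tsum_finsetSum fun j _ => h2 j]
  refine tsum_congr fun l => ?_
  have h3 := hdiv (n - l)
  rw [← sub_eq_zero, ← Finset.sum_sub_distrib]
  calc _ = I * a l * ∑ j, ((n - l) j : ℂ) * v j (n - l) := by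
        rw [Finset.mul_sum]
        refine Finset.sum_congr rfl fun j _ => ?_
        simp only [Pi.sub_apply]
        push_cast
        ring
    _ = 0 := by rw [h3, mul_zero]

/-- The constant of the estimates of the advection term. -/
def advConst (d m : ℕ) : ℝ := d ^ 2 * convConst d m

theorem advConst_nonneg (d m : ℕ) : 0 ≤ advConst d m :=
  mul_nonneg (sq_nonneg _) (convConst_nonneg d m)

/-- In divergence form, the advection term of two factors in `H^{m+1}` is in `H^m`. -/
theorem SobolevBound.adv {d m : ℕ} (hm : d < 2 * (m + 1)) {v : Fin d → (Fin d → ℤ) → ℂ}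
    {a : (Fin d → ℤ) → ℂ} {A B : ℝ} (hv : ∀ j, SobolevBound (m + 1) (v j) A)
    (ha : SobolevBound (m + 1) a B) (hv0 : ∀ j, v j 0 = 0) (ha0 : a 0 = 0) :
    SobolevBound m (adv v a) (advConst d (m + 1) * (A * B)) := by
  have h := SobolevBound.sum fun j => ((hv j).conv hm ha (hv0 j) ha0).gradCoeff j
  rwa [Fintype.card_fin, ← mul_assoc] at h

/-- For a divergence-free field, the derivative in the advection term may fall on the second factor
only. -/
theorem SobolevBound.adv_of_divFree {d m : ℕ} (hm : d < 2 * m) {v : Fin d → (Fin d → ℤ) → ℂ}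
    {a : (Fin d → ℤ) → ℂ} {A B : ℝ} (hv : ∀ j, SobolevBound m (v j) A)
    (ha : SobolevBound (m + 1) a B) (hv0 : ∀ j, v j 0 = 0) (ha0 : a 0 = 0) (hdiv : DivFree v) :
    SobolevBound m (AdvDiff.adv v a) (advConst d m * (A * B)) := by
  have h := SobolevBound.sum fun j =>
    (hv j).conv hm (ha.gradCoeff j) (hv0 j) (gradCoeff_zero j a)
  rw [Fintype.card_fin, ← mul_assoc] at h
  rwa [funext (adv_eq_sum_conv hm hv ha hv0 ha0 hdiv)]

theorem adv_add_left {d m : ℕ} (hm : d < 2 * m) {v v' : Fin d → (Fin d → ℤ) → ℂ}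
    {a : (Fin d → ℤ) → ℂ} {A A' B : ℝ} (hv : ∀ j, SobolevBound m (v j) A)
    (hv' : ∀ j, SobolevBound m (v' j) A') (ha : SobolevBound m a B) (hv0 : ∀ j, v j 0 = 0)
    (hv0' : ∀ j, v' j 0 = 0) (ha0 : a 0 = 0) (n : Fin d → ℤ) :
    adv (v + v') a n = adv v a n + adv v' a n := by
  rw [adv, adv, adv, ← Finset.sum_add_distrib]
  refine Finset.sum_congr rfl fun j _ => ?_
  rw [gradCoeff, gradCoeff, gradCoeff, Pi.add_apply,
    conv_add_left hm (hv j) (hv' j) ha (hv0 j) (hv0' j) ha0, mul_add]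

theorem adv_add_right {d m : ℕ} (hm : d < 2 * m) {v : Fin d → (Fin d → ℤ) → ℂ}
    {a a' : (Fin d → ℤ) → ℂ} {A B B' : ℝ} (hv : ∀ j, SobolevBound m (v j) A)
    (ha : SobolevBound m a B) (ha' : SobolevBound m a' B') (hv0 : ∀ j, v j 0 = 0)
    (ha0 : a 0 = 0) (ha0' : a' 0 = 0) (n : Fin d → ℤ) :
    adv v (a + a') n = adv v a n + adv v a' n := by
  rw [adv, adv, adv, ← Finset.sum_add_distrib]
  refine Finset.sum_congr rfl fun j _ => ?_
  rw [gradCoeff, gradCoeff, gradCoeff,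
    conv_add_right hm (hv j) ha ha' (hv0 j) ha0 ha0', mul_add]

theorem continuousOn_adv {d m : ℕ} (hm : d < 2 * m) {X : Type*} [TopologicalSpace X] {s : Set X}
    {v : X → Fin d → (Fin d → ℤ) → ℂ} {a : X → (Fin d → ℤ) → ℂ} {A B : ℝ}
    (hv : ∀ t ∈ s, ∀ j, SobolevBound m (v t j) A) (ha : ∀ t ∈ s, SobolevBound m (a t) B)
    (hv0 : ∀ t ∈ s, ∀ j, v t j 0 = 0) (ha0 : ∀ t ∈ s, a t 0 = 0)
    (hvc : ∀ j l, ContinuousOn (fun t => v t j l) s) (hac : ∀ l, ContinuousOn (fun t => a t l) s)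
    (n : Fin d → ℤ) : ContinuousOn (fun t => adv (v t) (a t) n) s :=
  continuousOn_finsetSum _ fun j _ => continuousOn_const.mul
    (continuousOn_conv hm (fun t ht => hv t ht j) ha (fun t ht => hv0 t ht j) ha0 (hvc j) hac n)

theorem hasDerivAt_adv {d m : ℕ} (hm : d < 2 * m) {s : Set ℝ} (hs : IsOpen s)
    (hs' : IsPreconnected s) {v v' : ℝ → Fin d → (Fin d → ℤ) → ℂ}
    {a a' : ℝ → (Fin d → ℤ) → ℂ} {A B A' B' : ℝ}
    (hv : ∀ t ∈ s, ∀ j, SobolevBound m (v t j) A) (ha : ∀ t ∈ s, SobolevBound m (a t) B)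
    (hv' : ∀ t ∈ s, ∀ j, SobolevBound m (v' t j) A') (ha' : ∀ t ∈ s, SobolevBound m (a' t) B')
    (hv0 : ∀ t ∈ s, ∀ j, v t j 0 = 0) (ha0 : ∀ t ∈ s, a t 0 = 0)
    (hv0' : ∀ t ∈ s, ∀ j, v' t j 0 = 0) (ha0' : ∀ t ∈ s, a' t 0 = 0)
    (hdv : ∀ j l, ∀ t ∈ s, HasDerivAt (fun t => v t j l) (v' t j l) t)
    (hda : ∀ l, ∀ t ∈ s, HasDerivAt (fun t => a t l) (a' t l) t)
    (n : Fin d → ℤ) {t : ℝ} (ht : t ∈ s) :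
    HasDerivAt (fun t => adv (v t) (a t) n) (adv (v' t) (a t) n + adv (v t) (a' t) n) t := by
  rw [adv, adv, ← Finset.sum_add_distrib]
  refine HasDerivAt.fun_sum fun j _ => ?_
  rw [gradCoeff, gradCoeff, ← mul_add]
  exact (hasDerivAt_conv hm hs hs' (fun t ht => hv t ht j) ha (fun t ht => hv' t ht j) ha'
    (fun t ht => hv0 t ht j) ha0 (fun t ht => hv0' t ht j) ha0' (hdv j) hda n ht).const_mul _

/-- The equation `ψ + v · ∇φ - Δφ = 0` on the Fourier side. -/
theorem AdvectionDiffusionAt.torusCoeff_eq {d m : ℕ} (hm : d < 2 * m) {v : Fin d → L2 d}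
    {φ ψ : L2 d} (h : AdvectionDiffusionAt v φ ψ) {A B : ℝ}
    (hv : ∀ j, SobolevBound m (torusCoeff (v j)) A) (hφ : SobolevBound (m + 1) (torusCoeff φ) B)
    (hv0 : ∀ j, torusCoeff (v j) 0 = 0) (hφ0 : torusCoeff φ 0 = 0)
    (hdiv : DivFree fun j => torusCoeff (v j)) (n : Fin d → ℤ) :
    torusCoeff ψ n = -(freq n : ℂ) ^ 2 * torusCoeff φ n -
      adv (fun j => torusCoeff (v j)) (torusCoeff φ) n := by
  obtain ⟨G, S, hG, hS, hae⟩ := h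
  have hGc : ∀ j, torusCoeff (G j) = gradCoeff j (torusCoeff φ) := fun j => funext fun l => hG j l
  have hprod : ∀ j, torusCoeff (fun x => v j x * G j x) n =
      conv (torusCoeff (v j)) (gradCoeff j (torusCoeff φ)) n := by
    intro j
    rw [torusCoeff_mul, hGc]
  have hzero : torusCoeff ψ n + ∑ j, torusCoeff (fun x => v j x * G j x) n -
      ∑ j, torusCoeff (S j) n = 0 := by
    have hadv : Integrable (fun x => ∑ j, character (-n) x * ((v j x * G j x : ℝ) : ℂ)) :=
      integrable_finsetSum _ fun j _ => integrable_character_mul_mul (v j) (G j) _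
    have hsum : Integrable (fun x => character (-n) x * ((ψ x : ℝ) : ℂ) +
        ∑ j, character (-n) x * ((v j x * G j x : ℝ) : ℂ)) :=
      (integrable_character_mul ψ _).add hadv
    simp only [torusCoeff]
    rw [← Finset.mul_sum, ← Finset.mul_sum, ← mul_add, ← mul_sub,
      ← integral_finsetSum _ fun j _ => integrable_character_mul_mul (v j) (G j) _,
      ← integral_finsetSum _ fun j _ => integrable_character_mul (S j) _,
      ← integral_add (integrable_character_mul ψ _) hadv,
      ← integral_sub hsum (integrable_finsetSum _ fun j _ => integrable_character_mul (S j) _)]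
    rw [integral_eq_zero_of_ae, mul_zero]
    filter_upwards [hae] with x hx
    have hx' := congrArg (fun r : ℝ => character (-n) x * (r : ℂ)) hx
    simp only [Complex.ofReal_zero, mul_zero] at hx'
    rw [Pi.zero_apply, ← hx', ← Finset.mul_sum, ← Finset.mul_sum, ← mul_add, ← mul_sub]
    push_cast
    rfl
  have hlap : ∑ j, torusCoeff (S j) n = -(freq n : ℂ) ^ 2 * torusCoeff φ n := by
    have h1 : (freq n : ℂ) ^ 2 = ∑ j, (n j : ℂ) ^ 2 := by
      have := congrArg (fun r : ℝ => (r : ℂ)) (sq_freq n)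
      push_cast at this
      exact this
    rw [h1, ← Finset.sum_neg_distrib, Finset.sum_mul]
    refine Finset.sum_congr rfl fun j _ => ?_
    rw [hS j n, hG j n]
    linear_combination (n j : ℂ) ^ 2 * torusCoeff φ n * Complex.I_sq
  rw [adv_eq_sum_conv hm hv hφ hv0 hφ0 hdiv, ← hlap, ← Finset.sum_congr rfl fun j _ => hprod j]
  linear_combination hzero

/-! ### Energy estimate and Grönwall's inequality -/

/-- The parabolic smoothing estimate: if `y' = Δy + h`, then the square of the norm of `y` in
`H^{m+1}` grows at most by half the time integral of the square of the norm of `h` in `H^m`. -/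
theorem SobolevBound.of_heat {d m : ℕ} {T : ℝ} {y h : ℝ → (Fin d → ℤ) → ℂ} {K : ℝ → ℝ}
    (hK : Continuous K) (hy : ∀ n, ContinuousOn (fun t => y t n) (Set.Icc 0 T))
    (hdy : ∀ n, ∀ t ∈ Set.Ioo 0 T,
      HasDerivAt (fun t => y t n) (-(freq n : ℂ) ^ 2 * y t n + h t n) t)
    (hh : ∀ t ∈ Set.Ioo 0 T, SobolevBound m (h t) (K t)) {A : ℝ}
    (h0 : SobolevBound (m + 1) (y 0) A) {t : ℝ} (ht : t ∈ Set.Icc 0 T) :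
    SobolevBound (m + 1) (y t) (A + 2⁻¹ * ∫ s in (0 : ℝ)..t, K s) := by
  intro F
  let E : ℝ → ℝ := fun t => ∑ n ∈ F, freq n ^ (2 * (m + 1)) * ‖y t n‖ ^ 2 -
    2⁻¹ * ∫ s in (0 : ℝ)..t, K s
  have hKd : ∀ t, HasDerivAt (fun t => ∫ s in (0 : ℝ)..t, K s) (K t) t := fun t =>
    (hK.integral_hasStrictDerivAt 0 t).hasDerivAt
  have hE : ∀ t ∈ Set.Ioo 0 T, HasDerivAt E (∑ n ∈ F, freq n ^ (2 * (m + 1)) *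
      (2 * inner ℝ (y t n) (-(freq n : ℂ) ^ 2 * y t n + h t n)) - 2⁻¹ * K t) t := fun t ht =>
    (HasDerivAt.fun_sum fun n _ => ((hdy n t ht).norm_sq.const_mul _)).sub
      ((hKd t).const_mul _)
  have hanti : AntitoneOn E (Set.Icc 0 T) := by
    refine antitoneOn_of_deriv_nonpos (convex_Icc 0 T) ?_ ?_ ?_
    · refine ContinuousOn.sub (continuousOn_finsetSum _ fun n _ =>
        continuousOn_const.mul ((hy n).norm.pow 2)) ?_
      exact (continuous_iff_continuousAt.2 fun t =>
        ((hKd t).const_mul _).continuousAt).continuousOn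
    · rw [interior_Icc]
      exact fun t ht => (hE t ht).differentiableAt.differentiableWithinAt
    · rw [interior_Icc]
      intro t ht
      rw [(hE t ht).deriv, sub_nonpos]
      have h1 := hh t ht F
      refine le_trans (Finset.sum_le_sum (g := fun n => 2⁻¹ * (freq n ^ (2 * m) * ‖h t n‖ ^ 2))
        fun n _ => ?_) ?_
      · have h2 : inner ℝ (y t n) (-(freq n : ℂ) ^ 2 * y t n + h t n) ≤
            -(freq n) ^ 2 * ‖y t n‖ ^ 2 + ‖y t n‖ * ‖h t n‖ := by
          have h3 : -(freq n : ℂ) ^ 2 * y t n = (-(freq n) ^ 2 : ℝ) • y t n := by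
            rw [Complex.real_smul]
            push_cast
            ring
          rw [inner_add_right, h3, real_inner_smul_right, real_inner_self_eq_norm_sq]
          gcongr
          exact real_inner_le_norm _ _
        have h4 : 0 ≤ freq n ^ (2 * m) := pow_nonneg (freq_nonneg _) _
        -- Completing the square: `2 q² ab ≤ 2 q⁴ a² + b² / 2`.
        have h5 : freq n ^ 2 * (2 * inner ℝ (y t n) (-(freq n : ℂ) ^ 2 * y t n + h t n)) ≤
            2⁻¹ * ‖h t n‖ ^ 2 := by
          have := mul_le_mul_of_nonneg_left h2 (sq_nonneg (freq n))
          nlinarith [sq_nonneg (2 * (freq n ^ 2 * ‖y t n‖) - ‖h t n‖)]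
        have h6 := mul_le_mul_of_nonneg_left h5 h4
        calc _ = freq n ^ (2 * m) * (freq n ^ 2 *
              (2 * inner ℝ (y t n) (-(freq n : ℂ) ^ 2 * y t n + h t n))) := by ring
          _ ≤ _ := h6
          _ = _ := by ring
      · rw [← Finset.mul_sum]
        linarith
  have h1 := hanti ⟨le_rfl, ht.1.trans ht.2⟩ ht ht.1
  simp only [E, intervalIntegral.integral_same, mul_zero, sub_zero] at h1
  have h2 := h0 F
  linarith

/-- Grönwall's inequality in integral form. -/
theorem le_mul_exp_of_le_add_integral {u : ℝ → ℝ} (hu : Continuous u) {A B T : ℝ} (hB : 0 ≤ B)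
    (h : ∀ t ∈ Set.Icc 0 T, u t ≤ A + B * ∫ s in (0 : ℝ)..t, u s) :
    ∀ t ∈ Set.Icc 0 T, u t ≤ A * Real.exp (B * t) := by
  have hd : ∀ t, HasDerivAt (fun t => A + B * ∫ s in (0 : ℝ)..t, u s) (B * u t) t := fun t =>
    ((hu.integral_hasStrictDerivAt 0 t).hasDerivAt.const_mul B).const_add A
  intro t ht
  have h1 := le_gronwallBound_of_liminf_deriv_right_le (δ := A) (K := B) (ε := 0)
    (f := fun t => A + B * ∫ s in (0 : ℝ)..t, u s) (f' := fun t => B * u t)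
    (fun t _ => (hd t).continuousAt.continuousWithinAt)
    (fun t _ r hr => (hd t).hasDerivWithinAt.liminf_right_slope_le hr)
    (by simp) (fun t ht => by
      rw [add_zero]
      exact mul_le_mul_of_nonneg_left (h t ⟨ht.1, ht.2.le⟩) hB) t ht
  rw [gronwallBound_ε0, sub_zero] at h1
  exact (h t ht).trans h1

theorem SobolevBound.interpolate {d m : ℕ} {a : (Fin d → ℤ) → ℂ} {A B : ℝ}
    (hA : SobolevBound m a A) (hB : SobolevBound (m + 2) a B) :
    SobolevBound (m + 1) a (Real.sqrt (A * B)) := by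
  intro F
  refine Real.le_sqrt_of_sq_le ?_
  have h1 := Finset.sum_mul_sq_le_sq_mul_sq F (fun n => freq n ^ m * ‖a n‖)
    (fun n => freq n ^ (m + 2) * ‖a n‖)
  have hA' := hA F
  have hB' := hB F
  calc _ = (∑ n ∈ F, freq n ^ m * ‖a n‖ * (freq n ^ (m + 2) * ‖a n‖)) ^ 2 := by
        congr 1
        exact Finset.sum_congr rfl fun n _ => by ring
    _ ≤ _ := h1
    _ = (∑ n ∈ F, freq n ^ (2 * m) * ‖a n‖ ^ 2) *
          ∑ n ∈ F, freq n ^ (2 * (m + 2)) * ‖a n‖ ^ 2 := by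
        simp only [mul_pow, ← pow_mul, mul_comm _ 2]
    _ ≤ A * B := mul_le_mul hA' hB' (Finset.sum_nonneg fun n _ =>
        mul_nonneg (pow_nonneg (freq_nonneg _) _) (sq_nonneg _)) hA.nonneg

/-! ### Fourier coefficients of Sobolev functions -/

/-- The Fourier coefficients of a function of `H^m`. -/
def Sobolev.coeff {d m : ℕ} (u : Sobolev d m) : (Fin d → ℤ) → ℂ := torusCoeff u.toL2

/-- A Fourier coefficient as a continuous linear functional on `H^m`. -/
def Sobolev.coeffL {d m : ℕ} (n : Fin d → ℤ) : Sobolev d m →L[ℝ] ℂ where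
  toFun u := u.coeff n
  map_add' u w := by simp only [Sobolev.coeff, map_add, torusCoeff_add]
  map_smul' c u := by simp [Sobolev.coeff, torusCoeff_smul]
  cont := by
    let e : Sobolev d m →L[ℝ] L2 d :=
      LinearMap.mkContinuous Sobolev.toL2 1 fun u => by
        rw [one_mul]
        exact Sobolev.norm_toL2_le_weightedCoeff u
    exact (Sobolev.continuous_torusCoeff n).comp e.continuous

theorem Sobolev.coeff_zero {d m : ℕ} (u : Sobolev d m) : u.coeff 0 = 0 :=
  Sobolev.torusCoeff_toL2_zero u

theorem Sobolev.coeff_incl {d l m : ℕ} (h : l ≤ m) (u : Sobolev d m) :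
    (Sobolev.incl h u).coeff = u.coeff := by
  rw [Sobolev.coeff, Sobolev.toL2_incl, Sobolev.coeff]

theorem Sobolev.coeff_sub {d m : ℕ} (u w : Sobolev d m) :
    (u - w).coeff = u.coeff - w.coeff :=
  funext fun n => map_sub (Sobolev.coeffL n) u w

theorem Sobolev.sobolevBound {d m : ℕ} (u : Sobolev d m) : SobolevBound m u.coeff (‖u‖ ^ 2) := by
  intro F
  have h1 : (1 : ℝ) ≤ (2 * Real.pi) ^ d := one_le_pow₀ (by linarith [Real.pi_gt_three])
  have hpos : ∀ n : Fin d → ℤ, 0 ≤ freq n ^ (2 * m) * ‖torusCoeff u.toL2 n‖ ^ 2 := fun n =>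
    mul_nonneg (pow_nonneg (freq_nonneg _) _) (sq_nonneg _)
  refine le_trans (Finset.sum_le_sum fun n _ => le_mul_of_one_le_left (hpos n) h1) ?_
  exact sum_le_hasSum F (fun n _ => mul_nonneg (by positivity) (hpos n))
    (Sobolev.norm_weightedCoeff_sq u)

theorem Sobolev.norm_sq_le {d m : ℕ} {u : Sobolev d m} {A : ℝ} (h : SobolevBound m u.coeff A) :
    ‖u‖ ^ 2 ≤ (2 * Real.pi) ^ d * A := by
  have hpos : (0 : ℝ) ≤ (2 * Real.pi) ^ d := by positivity
  refine hasSum_le_of_sum_le (Sobolev.norm_weightedCoeff_sq u) fun F => ?_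
  rw [← Finset.mul_sum]
  exact mul_le_mul_of_nonneg_left (h F) hpos

/-- The Fourier coefficients of the components of a vector field. -/
def vecCoeff {d m : ℕ} (v : VecSobolev d m) (j : Fin d) : (Fin d → ℤ) → ℂ := (v j).coeff

/-- A Fourier coefficient of a component of a vector field as a continuous linear functional. -/
def vecCoeffL {d m : ℕ} (j : Fin d) (n : Fin d → ℤ) : VecSobolev d m →L[ℝ] ℂ :=
  (Sobolev.coeffL n).comp (PiLp.proj 2 (fun _ : Fin d => Sobolev d m) j)

theorem vecCoeffL_apply {d m : ℕ} (j : Fin d) (n : Fin d → ℤ) (v : VecSobolev d m) :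
    vecCoeffL j n v = vecCoeff v j n := rfl

theorem vecCoeff_zero {d m : ℕ} (v : VecSobolev d m) (j : Fin d) : vecCoeff v j 0 = 0 :=
  Sobolev.coeff_zero _

theorem sobolevBound_vecCoeff {d m : ℕ} (v : VecSobolev d m) (j : Fin d) :
    SobolevBound m (vecCoeff v j) (‖v‖ ^ 2) :=
  (v j).sobolevBound.mono (pow_le_pow_left₀ (norm_nonneg _) (PiLp.norm_apply_le v j) 2)

theorem SobolevSigma.divFree {d m : ℕ} (v : SobolevSigma d m) :
    DivFree (vecCoeff (v : VecSobolev d m)) := by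
  intro n
  have h := v.2 n
  simp only [mul_assoc, ← Finset.mul_sum] at h
  exact (mul_eq_zero.1 h).resolve_left Complex.I_ne_zero

/-- The inclusion `H^m(𝕋^d; ℝ^d) ⊆ H^l(𝕋^d; ℝ^d)` for `l ≤ m`. -/
def vecIncl {d l m : ℕ} (h : l ≤ m) : VecSobolev d m →L[ℝ] VecSobolev d l :=
  (PiLp.continuousLinearEquiv 2 ℝ (fun _ : Fin d => Sobolev d l)).symm.toContinuousLinearMap.comp
    (ContinuousLinearMap.pi fun j =>
      (Sobolev.incl h).comp (PiLp.proj 2 (fun _ : Fin d => Sobolev d m) j))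

theorem vecCoeff_vecIncl {d l m : ℕ} (h : l ≤ m) (v : VecSobolev d m) :
    vecCoeff (vecIncl h v) = vecCoeff v :=
  funext fun j => Sobolev.coeff_incl h (v j)

/-! ### Integrals over the time interval -/

theorem setIntegral_timeMeasure {E : Type*} [NormedAddCommGroup E] [NormedSpace ℝ E] {T : ℝ}
    (hT : 0 ≤ T) (F : TimeInterval T → E) {S : Set ℝ} (hS : MeasurableSet S) :
    ∫ r in Subtype.val ⁻¹' S, F r ∂(timeMeasure T) =
      ∫ r in Set.Icc 0 T ∩ S, F (Set.projIcc 0 T hT r) := by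
  rw [← integral_indicator (measurable_subtype_coe hS), timeMeasure, ← setIntegral_indicator hS,
    ← integral_subtype_comap measurableSet_Icc]
  refine integral_congr_ae (Filter.Eventually.of_forall fun r => ?_)
  by_cases hr : (r : ℝ) ∈ S
  · simp [Set.indicator, hr, Set.projIcc_val]
  · simp [Set.indicator, hr]

theorem setIntegral_Ioc_timeMeasure {E : Type*} [NormedAddCommGroup E] [NormedSpace ℝ E] {T : ℝ}
    (hT : 0 ≤ T) (F : TimeInterval T → E) {s t : TimeInterval T} (hst : s ≤ t) :
    ∫ r in Set.Ioc s t, F r ∂(timeMeasure T) =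
      ∫ r in (s : ℝ)..t, F (Set.projIcc 0 T hT r) := by
  have h1 : Set.Ioc s t = Subtype.val ⁻¹' (Set.Ioc (s : ℝ) t) := rfl
  have h2 : Set.Icc 0 T ∩ Set.Ioc (s : ℝ) t = Set.Ioc (s : ℝ) t :=
    Set.inter_eq_right.2 fun r hr => ⟨s.2.1.trans hr.1.le, hr.2.trans t.2.2⟩
  rw [h1, setIntegral_timeMeasure hT F measurableSet_Ioc, h2,
    intervalIntegral.integral_of_le hst]

theorem setIntegral_Iic_timeMeasure {E : Type*} [NormedAddCommGroup E] [NormedSpace ℝ E] {T : ℝ}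
    (hT : 0 ≤ T) (F : TimeInterval T → E) (t : TimeInterval T) :
    ∫ r in Set.Iic t, F r ∂(timeMeasure T) =
      ∫ r in (0 : ℝ)..t, F (Set.projIcc 0 T hT r) := by
  have h1 : Set.Iic t = Subtype.val ⁻¹' (Set.Iic (t : ℝ)) := rfl
  have h2 : Set.Icc 0 T ∩ Set.Iic (t : ℝ) = Set.Icc 0 (t : ℝ) := by
    ext r
    simp only [Set.mem_inter_iff, Set.mem_Icc, Set.mem_Iic]
    exact ⟨fun h => ⟨h.1.1, h.2⟩, fun h => ⟨⟨h.1, h.2.trans t.2.2⟩, h.2⟩⟩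
  rw [h1, setIntegral_timeMeasure hT F measurableSet_Iic, h2, integral_Icc_eq_integral_Ioc,
    intervalIntegral.integral_of_le t.2.1]

instance isFiniteMeasure_timeMeasure (T : ℝ) : IsFiniteMeasure (timeMeasure T) := by
  constructor
  rw [timeMeasure, Measure.comap_apply _ Subtype.val_injective
    (fun s hs => measurableSet_Icc.subtype_image hs) _ MeasurableSet.univ, Set.image_univ,
    Subtype.range_coe, Real.volume_Icc]
  exact ENNReal.ofReal_lt_top

/-- If `u ∈ H¹(J_T; X)` and the image of its time derivative under a continuous linear map `L` is
almost everywhere equal to a continuous function, then `L u` is differentiable in the classical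
sense. -/
theorem hasDerivAt_of_ae {X E : Type*} [NormedAddCommGroup X] [NormedSpace ℝ X] [CompleteSpace X]
    [NormedAddCommGroup E] [NormedSpace ℝ E] [CompleteSpace E] {T : ℝ} (hT : 0 ≤ T)
    {u w : TimeInterval T → X} (h : HasTimeDeriv u w) (L : X →L[ℝ] E) {q : TimeInterval T → E}
    (hq : Continuous q) (hae : ∀ᵐ t ∂(timeMeasure T), L (w t) = q t) {t : ℝ}
    (ht : t ∈ Set.Ioo 0 T) :
    HasDerivAt (fun t => L (u (Set.projIcc 0 T hT t))) (q (Set.projIcc 0 T hT t)) t := by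
  have hint : ∀ s ∈ Set.Icc 0 T, L (u (Set.projIcc 0 T hT s)) =
      L (u ⟨0, le_rfl, hT⟩) + ∫ r in (0 : ℝ)..s, q (Set.projIcc 0 T hT r) := by
    intro s hs
    rw [Set.projIcc_of_mem hT hs]
    have h1 := h.2 ⟨0, le_rfl, hT⟩ ⟨s, hs⟩ hs.1
    have h2 := congrArg L h1
    rw [← L.integral_comp_comm (h.1.integrable (by norm_num)).integrableOn, map_sub,
      integral_congr_ae (ae_restrict_of_ae hae),
      setIntegral_Ioc_timeMeasure hT q (s := ⟨0, le_rfl, hT⟩) (t := ⟨s, hs⟩) hs.1] at h2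
    rw [← h2]
    abel
  have hqc : Continuous fun r => q (Set.projIcc 0 T hT r) := hq.comp continuous_projIcc
  refine HasDerivAt.congr_of_eventuallyEq
    ((hqc.integral_hasStrictDerivAt 0 t).hasDerivAt.const_add (L (u ⟨0, le_rfl, hT⟩))) ?_
  filter_upwards [isOpen_Ioo.mem_nhds ht] with s hs
  exact hint s ⟨hs.1.le, hs.2.le⟩

/-! ### Solutions in Fourier space -/

theorem SobolevBound.freq_sq_mul {d m : ℕ} {a : (Fin d → ℤ) → ℂ} {A : ℝ}
    (ha : SobolevBound (m + 2) a A) : SobolevBound m (fun n => (freq n : ℂ) ^ 2 * a n) A := by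
  have hn : ∀ n : Fin d → ℤ, ‖(freq n : ℂ)‖ = freq n := fun n => by
    rw [Complex.norm_real, Real.norm_eq_abs, abs_of_nonneg (freq_nonneg n)]
  have h1 : SobolevBound (m + 1) (fun n => (freq n : ℂ) * a n) A :=
    SobolevBound.of_norm_le_freq_mul ha fun n => by rw [norm_mul, hn]
  exact h1.of_norm_le_freq_mul fun n => by rw [sq, mul_assoc, norm_mul, hn]

/-- The Fourier coefficients of the time derivative `Δa - v · ∇a`. -/
def timeDerivCoeff {d : ℕ} (v : Fin d → (Fin d → ℤ) → ℂ) (a : (Fin d → ℤ) → ℂ)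
    (n : Fin d → ℤ) : ℂ := -(freq n : ℂ) ^ 2 * a n - adv v a n

theorem timeDerivCoeff_zero {d : ℕ} (v : Fin d → (Fin d → ℤ) → ℂ) (a : (Fin d → ℤ) → ℂ) :
    timeDerivCoeff v a 0 = 0 := by
  simp [timeDerivCoeff, adv_zero, freq_zero]

theorem SobolevBound.timeDerivCoeff {d m : ℕ} (hm : d < 2 * (m + 1))
    {v : Fin d → (Fin d → ℤ) → ℂ} {a : (Fin d → ℤ) → ℂ} {A B : ℝ}
    (hv : ∀ j, SobolevBound (m + 1) (v j) A) (ha : SobolevBound (m + 2) a B)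
    (hv0 : ∀ j, v j 0 = 0) (ha0 : a 0 = 0) :
    SobolevBound m (timeDerivCoeff v a) (2 * B + 2 * (advConst d (m + 1) * (A * B))) := by
  have h := ha.freq_sq_mul.neg.add
    (SobolevBound.adv hm hv (ha.of_le (Nat.le_succ _) ha0) hv0 ha0).neg
  convert h using 1
  funext n
  simp [AdvDiff.timeDerivCoeff, sub_eq_add_neg]

section Solution

variable {d k : ℕ} {T : ℝ} {hT : 0 ≤ T} {v : C(TimeInterval T, SobolevSigma d (k + 2))}
  {f : Sobolev d (k + 2)} {φ : C(TimeInterval T, Sobolev d (k + 2))}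

theorem sobolevBound_path (φ : C(TimeInterval T, Sobolev d (k + 2))) {R : ℝ} (hR : ‖φ‖ ≤ R)
    (t : TimeInterval T) : SobolevBound (k + 2) (φ t).coeff (R ^ 2) :=
  (φ t).sobolevBound.mono (pow_le_pow_left₀ (norm_nonneg _) ((φ.norm_coe_le_norm t).trans hR) 2)

theorem sobolevBound_vecPath (v : C(TimeInterval T, SobolevSigma d (k + 2))) {R : ℝ}
    (hR : ‖v‖ ≤ R) (t : TimeInterval T) (j : Fin d) :
    SobolevBound (k + 2) (vecCoeff (v t : VecSobolev d (k + 2)) j) (R ^ 2) :=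
  (sobolevBound_vecCoeff (v t : VecSobolev d (k + 2)) j).mono
    (pow_le_pow_left₀ (norm_nonneg _) ((v.norm_coe_le_norm t).trans hR) 2)

/-- The Fourier coefficients of a solution are differentiable in the classical sense, because the
right-hand side of the equation has continuous coefficients. -/
theorem IsSolution.hasDerivAt_coeff (h : IsSolution hT v f φ) (hk : d < 2 * k) (n : Fin d → ℤ)
    {t : ℝ} (ht : t ∈ Set.Ioo 0 T) :
    HasDerivAt (fun t => (φ (Set.projIcc 0 T hT t)).coeff n)
      (timeDerivCoeff (vecCoeff (v (Set.projIcc 0 T hT t) : VecSobolev d (k + 2)))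
        (φ (Set.projIcc 0 T hT t)).coeff n) t := by
  obtain ⟨ψ, hψ, hae⟩ := h.equation
  have hcont : Continuous fun t =>
      timeDerivCoeff (vecCoeff (v t : VecSobolev d (k + 2))) (φ t).coeff n := by
    have h1 : ∀ l, Continuous fun t => (φ t).coeff l := fun l =>
      (Sobolev.coeffL l).continuous.comp φ.continuous
    have h2 : ∀ j l, Continuous fun t => vecCoeff (v t : VecSobolev d (k + 2)) j l := fun j l =>
      (vecCoeffL j l).continuous.comp (continuous_subtype_val.comp v.continuous)
    refine (continuous_const.mul (h1 n)).sub (continuousOn_univ.1 ?_)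
    exact continuousOn_adv (m := k + 2) (by omega)
      (fun t _ j => sobolevBound_vecPath v le_rfl t j)
      (fun t _ => sobolevBound_path φ le_rfl t) (fun t _ j => vecCoeff_zero _ j)
      (fun t _ => Sobolev.coeff_zero _) (fun j l => (h2 j l).continuousOn)
      (fun l => (h1 l).continuousOn) n
  have hae' : ∀ᵐ t ∂(timeMeasure T), Sobolev.coeffL n (ψ t) =
      timeDerivCoeff (vecCoeff (v t : VecSobolev d (k + 2))) (φ t).coeff n := by
    filter_upwards [hae] with t ht
    exact ht.torusCoeff_eq (m := k + 1) (by omega)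
      (fun j => (sobolevBound_vecPath v le_rfl t j).of_le (by omega) (vecCoeff_zero _ j))
      (sobolevBound_path φ le_rfl t) (fun j => vecCoeff_zero (v t : VecSobolev d (k + 2)) j)
      (Sobolev.coeff_zero (φ t)) (SobolevSigma.divFree (v t)) n
  have h3 := hasDerivAt_of_ae hT hψ (Sobolev.coeffL n) hcont hae' ht
  have h4 : ∀ t, Sobolev.coeffL n (inclC (Nat.le_succ (k + 1)) φ t) = (φ t).coeff n := fun t =>
    congrFun (Sobolev.coeff_incl (Nat.le_succ (k + 1)) (φ t)) n
  simpa only [h4] using h3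

/-- The bound of the square of the norm of a solution in `H^{k+2}`. -/
def aprioriBound (d k : ℕ) (T R : ℝ) : ℝ :=
  (2 * Real.pi) ^ d * R ^ 2 *
    Real.exp ((2 * Real.pi) ^ d * 2⁻¹ * (advConst d (k + 2) * R ^ 2) * T)

theorem aprioriBound_nonneg (d k : ℕ) (T R : ℝ) : 0 ≤ aprioriBound d k T R :=
  mul_nonneg (mul_nonneg (by positivity) (sq_nonneg R)) (Real.exp_pos _).le

theorem IsSolution.norm_sq_le (h : IsSolution hT v f φ) (hk : d < 2 * k) {R : ℝ}
    (hf : ‖f‖ ≤ R) (hv : ‖v‖ ≤ R) (t : TimeInterval T) :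
    ‖φ t‖ ^ 2 ≤ aprioriBound d k T R := by
  set P : ℝ := (2 * Real.pi) ^ d with hP
  have hP0 : 0 ≤ P := by positivity
  set c : ℝ := advConst d (k + 2) * R ^ 2 with hc
  have hc0 : 0 ≤ c := mul_nonneg (advConst_nonneg _ _) (sq_nonneg _)
  have hcont : Continuous fun t => φ (Set.projIcc 0 T hT t) := φ.continuous.comp continuous_projIcc
  have hu : Continuous fun t => ‖φ (Set.projIcc 0 T hT t)‖ ^ 2 := hcont.norm.pow 2
  have hmain : ∀ s ∈ Set.Icc 0 T, ‖φ (Set.projIcc 0 T hT s)‖ ^ 2 ≤ P * R ^ 2 +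
      P * 2⁻¹ * c * ∫ r in (0 : ℝ)..s, ‖φ (Set.projIcc 0 T hT r)‖ ^ 2 := by
    intro s hs
    have h0 : SobolevBound (k + 2) (φ (Set.projIcc 0 T hT 0)).coeff (R ^ 2) := by
      rw [Set.projIcc_left, h.initial]
      exact f.sobolevBound.mono (pow_le_pow_left₀ (norm_nonneg _) hf 2)
    have h1 := SobolevBound.of_heat (m := k + 1) (T := T)
      (y := fun t => (φ (Set.projIcc 0 T hT t)).coeff)
      (h := fun t => -adv (vecCoeff (v (Set.projIcc 0 T hT t) : VecSobolev d (k + 2)))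
        (φ (Set.projIcc 0 T hT t)).coeff)
      (K := fun t => c * ‖φ (Set.projIcc 0 T hT t)‖ ^ 2) (continuous_const.mul hu)
      (fun n => ((Sobolev.coeffL n).continuous.comp hcont).continuousOn)
      (fun n t ht => by
        have h2 := h.hasDerivAt_coeff hk n ht
        rwa [timeDerivCoeff, sub_eq_add_neg] at h2)
      (fun t _ => by
        rw [hc, mul_assoc]
        exact (SobolevBound.adv (m := k + 1) (by omega)
          (fun j => sobolevBound_vecPath v hv _ j) (Sobolev.sobolevBound _)
          (fun j => vecCoeff_zero _ j) (Sobolev.coeff_zero _)).neg) h0 hs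
    have h2 := Sobolev.norm_sq_le h1
    rw [intervalIntegral.integral_const_mul] at h2
    refine h2.trans (le_of_eq ?_)
    ring
  have h1 := le_mul_exp_of_le_add_integral hu (by positivity) hmain t t.2
  rw [Set.projIcc_val] at h1
  refine h1.trans ?_
  rw [aprioriBound]
  have := t.2.2
  gcongr

end Solution

/-! ### The difference of two solutions -/

/-- If `a₁` and `a₂` solve the advection–diffusion equations of the fields `v₁` and `v₂`, the
difference `w = a₁ - a₂` is estimated through `z = w + V · ∇a₂`, where `V`
is a primitive of `v₁ - v₂`: in the equation of `z` the field `v₁ - v₂` only appears through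
`V`. -/
theorem sobolevBound_sub_of_solutions {d p : ℕ} (hp : d < 2 * (p + 1)) {T : ℝ}
    {v₁ v₂ V : ℝ → Fin d → (Fin d → ℤ) → ℂ} {a₁ a₂ : ℝ → (Fin d → ℤ) → ℂ} {N : ℝ → ℝ}
    (hN : Continuous N) {Q M D : ℝ}
    (hv₁ : ∀ t j, SobolevBound (p + 3) (v₁ t j) Q) (hv₂ : ∀ t j, SobolevBound (p + 3) (v₂ t j) Q)
    (ha₂ : ∀ t, SobolevBound (p + 3) (a₂ t) M)
    (hV : ∀ t ∈ Set.Icc 0 T, ∀ j, SobolevBound (p + 2) (V t j) D)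
    (hv₁0 : ∀ t j, v₁ t j 0 = 0) (hv₂0 : ∀ t j, v₂ t j 0 = 0) (ha₁0 : ∀ t, a₁ t 0 = 0)
    (ha₂0 : ∀ t, a₂ t 0 = 0) (hV0 : ∀ t j, V t j 0 = 0) (hdiv : ∀ t, DivFree (V t))
    (hc₁ : ∀ n, Continuous fun t => a₁ t n) (hc₂ : ∀ n, Continuous fun t => a₂ t n)
    (hd₁ : ∀ n, ∀ t ∈ Set.Ioo 0 T,
      HasDerivAt (fun t => a₁ t n) (timeDerivCoeff (v₁ t) (a₁ t) n) t)
    (hd₂ : ∀ n, ∀ t ∈ Set.Ioo 0 T,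
      HasDerivAt (fun t => a₂ t n) (timeDerivCoeff (v₂ t) (a₂ t) n) t)
    (hdV : ∀ j n t, HasDerivAt (fun t => V t j n) (v₁ t j n - v₂ t j n) t)
    (h0 : a₁ 0 = a₂ 0) (hVi : V 0 = 0)
    (hw : ∀ t, SobolevBound (p + 1) (a₁ t - a₂ t) (N t)) {t : ℝ} (ht : t ∈ Set.Icc 0 T) :
    SobolevBound (p + 1) (a₁ t - a₂ t)
      ((∫ s in (0 : ℝ)..t, (4 * (advConst d (p + 2) * (D * M)) + 4 * (advConst d (p + 1) *
          (D * (2 * M + 2 * (advConst d (p + 2) * (Q * M))))) +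
          2 * (advConst d (p + 1) * (Q * N s)))) + 2 * (advConst d (p + 2) * (D * M))) := by
  set Ψ : ℝ := 2 * M + 2 * (advConst d (p + 2) * (Q * M)) with hΨ
  have hψ : ∀ t, SobolevBound (p + 1) (timeDerivCoeff (v₂ t) (a₂ t)) Ψ := fun t =>
    SobolevBound.timeDerivCoeff (by omega)
      (fun j => (hv₂ t j).of_le (by omega) (hv₂0 t j)) (ha₂ t) (hv₂0 t) (ha₂0 t)
  have hg : ∀ t ∈ Set.Icc 0 T,
      SobolevBound (p + 2) (adv (V t) (a₂ t)) (advConst d (p + 2) * (D * M)) := fun t ht =>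
    SobolevBound.adv_of_divFree (by omega) (hV t ht) (ha₂ t) (hV0 t) (ha₂0 t) (hdiv t)
  have hv₁' : ∀ t j, SobolevBound (p + 1) (v₁ t j) Q := fun t j =>
    (hv₁ t j).of_le (by omega) (hv₁0 t j)
  have hv₂' : ∀ t j, SobolevBound (p + 1) (v₂ t j) Q := fun t j =>
    (hv₂ t j).of_le (by omega) (hv₂0 t j)
  have ha₂' : ∀ t, SobolevBound (p + 1) (a₂ t) M := fun t => (ha₂ t).of_le (by omega) (ha₂0 t)
  have hV' : ∀ t ∈ Set.Icc 0 T, ∀ j, SobolevBound (p + 1) (V t j) D := fun t ht j =>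
    (hV t ht j).of_le (by omega) (hV0 t j)
  have hw0 : ∀ t, (a₁ t - a₂ t) 0 = 0 := fun t => by simp [ha₁0, ha₂0]
  have hdiff : ∀ t j, SobolevBound (p + 1) ((v₁ t - v₂ t) j) (2 * Q + 2 * Q) := fun t j => by
    simpa [sub_eq_add_neg] using (hv₁' t j).add (hv₂' t j).neg
  have hdiff0 : ∀ t j, (v₁ t - v₂ t) j 0 = 0 := fun t j => by simp [hv₁0, hv₂0]
  let z : ℝ → (Fin d → ℤ) → ℂ := fun t => (a₁ t - a₂ t) + adv (V t) (a₂ t)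
  let h : ℝ → (Fin d → ℤ) → ℂ := fun t =>
    ((fun n => (freq n : ℂ) ^ 2 * adv (V t) (a₂ t) n) +
      adv (V t) (timeDerivCoeff (v₂ t) (a₂ t))) + -adv (v₁ t) (a₁ t - a₂ t)
  have hIcc : Set.Ioo 0 T ⊆ Set.Icc 0 T := Set.Ioo_subset_Icc_self
  have hzc : ∀ n, ContinuousOn (fun t => z t n) (Set.Icc 0 T) := fun n =>
    ((hc₁ n).sub (hc₂ n)).continuousOn.add (continuousOn_adv hp hV' (fun t _ => ha₂' t)
      (fun t _ => hV0 t) (fun t _ => ha₂0 t)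
      (fun j l => (continuous_iff_continuousAt.2 fun t => (hdV j l t).continuousAt).continuousOn)
      (fun l => (hc₂ l).continuousOn) n)
  have hzd : ∀ n, ∀ t ∈ Set.Ioo 0 T,
      HasDerivAt (fun t => z t n) (-(freq n : ℂ) ^ 2 * z t n + h t n) t := by
    intro n t ht
    have h1 := hasDerivAt_adv hp isOpen_Ioo isPreconnected_Ioo (v' := fun t => v₁ t - v₂ t)
      (fun t ht => hV' t (hIcc ht)) (fun t _ => ha₂' t) (fun t _ => hdiff t) (fun t _ => hψ t)
      (fun t _ => hV0 t) (fun t _ => ha₂0 t) (fun t _ => hdiff0 t)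
      (fun t _ => timeDerivCoeff_zero _ _) (fun j l t _ => hdV j l t) hd₂ n ht
    have h2 := ((hd₁ n t ht).sub (hd₂ n t ht)).add h1
    refine h2.congr_deriv ?_
    have h3 : adv (v₁ t) (a₁ t) n = adv (v₁ t) (a₁ t - a₂ t) n + adv (v₁ t) (a₂ t) n := by
      rw [← adv_add_right hp (hv₁' t) (hw t) (ha₂' t) (hv₁0 t) (hw0 t) (ha₂0 t), sub_add_cancel]
    have h4 : adv (v₁ t) (a₂ t) n = adv (v₁ t - v₂ t) (a₂ t) n + adv (v₂ t) (a₂ t) n := by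
      rw [← adv_add_left hp (hdiff t) (hv₂' t) (ha₂' t) (hdiff0 t) (hv₂0 t) (ha₂0 t),
        sub_add_cancel]
    simp only [z, h, Pi.add_apply, Pi.sub_apply, Pi.neg_apply]
    rw [timeDerivCoeff, timeDerivCoeff, h3, h4]
    ring
  have hh : ∀ t ∈ Set.Ioo 0 T, SobolevBound p (h t)
      (4 * (advConst d (p + 2) * (D * M)) + 4 * (advConst d (p + 1) * (D * Ψ)) +
        2 * (advConst d (p + 1) * (Q * N t))) := by
    intro t ht
    have h1 := (((hg t (hIcc ht)).freq_sq_mul).add (SobolevBound.adv hp (hV' t (hIcc ht)) (hψ t)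
      (hV0 t) (timeDerivCoeff_zero _ _))).add
      (SobolevBound.adv hp (hv₁' t) (hw t) (hv₁0 t) (hw0 t)).neg
    exact h1.mono (le_of_eq (by ring))
  have hz0 : SobolevBound (p + 1) (z 0) 0 := by
    have : z 0 = 0 := by
      funext n
      simp [z, h0, hVi, adv, gradCoeff, conv]
    intro F
    simp [this]
  have hz := SobolevBound.of_heat (by fun_prop) hzc hzd hh hz0 ht
  have hwz : a₁ t - a₂ t = z t + -adv (V t) (a₂ t) := by simp [z]
  rw [hwz]
  refine (hz.add ((hg t ht).of_le (Nat.le_succ _) (adv_zero _ _)).neg).mono (le_of_eq ?_)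
  ring

/-! ### The relaxation norm and primitives of time-dependent fields -/

theorem norm_integral_le_mul {X : Type*} [NormedAddCommGroup X] [NormedSpace ℝ X] {T : ℝ}
    (hT : 0 ≤ T) (F : C(TimeInterval T, X)) {B : ℝ} (hB : ‖F‖ ≤ B) {t : ℝ}
    (ht : t ∈ Set.Icc 0 T) : ‖∫ r in (0 : ℝ)..t, F (Set.projIcc 0 T hT r)‖ ≤ T * B := by
  have h1 := intervalIntegral.norm_integral_le_of_norm_le_const (a := 0) (b := t) (C := B)
    (f := fun r => F (Set.projIcc 0 T hT r)) fun r _ => (F.norm_coe_le_norm _).trans hB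
  rw [sub_zero, abs_of_nonneg ht.1] at h1
  have h2 : 0 ≤ B := (norm_nonneg _).trans hB
  have h3 := mul_le_mul_of_nonneg_left ht.2 h2
  linarith

/-- The supremum in the relaxation norm of a continuous path is that of a bounded family of reals, so
that it has no junk value and is an upper bound. -/
theorem norm_integral_le_relaxationNorm {X : Type*} [NormedAddCommGroup X] [NormedSpace ℝ X]
    {T : ℝ} (hT : 0 ≤ T) (F : C(TimeInterval T, X)) {t : ℝ} (ht : t ∈ Set.Icc 0 T) :
    ‖∫ r in (0 : ℝ)..t, F (Set.projIcc 0 T hT r)‖ ≤ relaxationNorm F := by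
  have hbdd : BddAbove (Set.range fun t : TimeInterval T =>
      ‖∫ s in Set.Iic t, F s ∂(timeMeasure T)‖) := by
    refine ⟨T * ‖F‖, ?_⟩
    rintro _ ⟨s, rfl⟩
    simp only
    rw [setIntegral_Iic_timeMeasure hT]
    exact norm_integral_le_mul hT F le_rfl s.2
  have h1 := le_ciSup hbdd ⟨t, ht⟩
  rwa [setIntegral_Iic_timeMeasure hT] at h1

section Primitive

variable {d m : ℕ} {T : ℝ} {hT : 0 ≤ T}

/-- The primitive `∫_0^t F(s) ds` of a continuous path of vector fields; outside of `J_T` the path is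
extended by its values at the end points. -/
def primitive (hT : 0 ≤ T) (F : C(TimeInterval T, VecSobolev d m)) (t : ℝ) : VecSobolev d m :=
  ∫ r in (0 : ℝ)..t, F (Set.projIcc 0 T hT r)

theorem continuous_comp_projIcc {X : Type*} [TopologicalSpace X] (hT : 0 ≤ T)
    (F : C(TimeInterval T, X)) : Continuous fun r => F (Set.projIcc 0 T hT r) :=
  F.continuous.comp continuous_projIcc

theorem hasDerivAt_vecCoeff_primitive (F : C(TimeInterval T, VecSobolev d m)) (j : Fin d)
    (n : Fin d → ℤ) (t : ℝ) : HasDerivAt (fun t => vecCoeff (primitive hT F t) j n)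
      (vecCoeff (F (Set.projIcc 0 T hT t)) j n) t := by
  have h : HasDerivAt (primitive hT F) (F (Set.projIcc 0 T hT t)) t :=
    ((continuous_comp_projIcc hT F).integral_hasStrictDerivAt 0 t).hasDerivAt
  simp only [← vecCoeffL_apply]
  exact (vecCoeffL j n).hasFDerivAt.comp_hasDerivAt t h

theorem vecCoeff_primitive_zero (F : C(TimeInterval T, VecSobolev d m)) :
    vecCoeff (primitive hT F 0) = 0 := by
  funext j n
  rw [primitive, intervalIntegral.integral_same]
  exact map_zero (vecCoeffL j n)

theorem divFree_primitive {F : C(TimeInterval T, VecSobolev d m)}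
    (hF : ∀ t, DivFree (vecCoeff (F t))) (t : ℝ) : DivFree (vecCoeff (primitive hT F t)) := by
  intro n
  let L : VecSobolev d m →L[ℝ] ℂ := ∑ j, (n j : ℝ) • vecCoeffL j n
  have hL : ∀ u, L u = ∑ j, (n j : ℂ) * vecCoeff u j n := fun u => by
    simp [L, vecCoeffL_apply]
  rw [← hL, primitive,
    ← L.intervalIntegral_comp_comm ((continuous_comp_projIcc hT F).intervalIntegrable 0 t)]
  refine (intervalIntegral.integral_congr fun r _ => ?_).trans intervalIntegral.integral_zero
  simp only [hL]
  exact hF _ n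

/-- A path of fields that is bounded in `H^{m+2}` and small in the relaxation norm of `H^m` has a
small primitive in `H^{m+1}`. The interpolation of `H^{m+1}` between `H^m` and `H^{m+2}` is the
origin of the square root of the relaxation norm. -/
theorem sobolevBound_primitive (F : C(TimeInterval T, VecSobolev d (m + 2))) {R : ℝ}
    (hF : ‖F‖ ≤ R) {t : ℝ} (ht : t ∈ Set.Icc 0 T) (j : Fin d) :
    SobolevBound (m + 1) (vecCoeff (primitive hT F t) j)
      (relaxationNorm (fun t => vecIncl (Nat.le_add_right m 2) (F t)) * (T * R)) := by
  let F' : C(TimeInterval T, VecSobolev d m) :=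
    ⟨fun t => vecIncl (Nat.le_add_right m 2) (F t),
      (vecIncl (Nat.le_add_right m 2)).continuous.comp F.continuous⟩
  have h1 : ‖vecIncl (Nat.le_add_right m 2) (primitive hT F t)‖ ≤ relaxationNorm F' := by
    rw [primitive, ← (vecIncl (Nat.le_add_right m 2)).intervalIntegral_comp_comm
      ((continuous_comp_projIcc hT F).intervalIntegrable 0 t)]
    exact norm_integral_le_relaxationNorm hT F' ht
  have h2 : ‖primitive hT F t‖ ≤ T * R := norm_integral_le_mul hT F hF ht
  have h3 := (sobolevBound_vecCoeff (vecIncl (Nat.le_add_right m 2) (primitive hT F t)) j).mono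
    (pow_le_pow_left₀ (norm_nonneg _) h1 2)
  rw [vecCoeff_vecIncl] at h3
  have h4 := (sobolevBound_vecCoeff (primitive hT F t) j).mono
    (pow_le_pow_left₀ (norm_nonneg _) h2 2)
  refine (h3.interpolate h4).mono (le_of_eq ?_)
  rw [← mul_pow, Real.sqrt_sq (mul_nonneg ((norm_nonneg _).trans h1) ((norm_nonneg _).trans h2))]
  rfl

end Primitive

/-! ### Continuity with respect to the relaxation norm -/

/-- The integral inequality for the square of the `H^k` norm of the difference of two solutions,
where `k = p + 1`; the constants only depend on `d`, `p`, `T` and `R`. -/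
theorem IsSolution.norm_sub_sq_le {d p : ℕ} (hk : d < 2 * (p + 1)) {T R : ℝ} {hT : 0 ≤ T}
    {f : Sobolev d (p + 1 + 2)} {v₁ v₂ : C(TimeInterval T, SobolevSigma d (p + 1 + 2))}
    {φ₁ φ₂ : C(TimeInterval T, Sobolev d (p + 1 + 2))} (h₁ : IsSolution hT v₁ f φ₁)
    (h₂ : IsSolution hT v₂ f φ₂) (hf : ‖f‖ ≤ R) (hv₁ : ‖v₁‖ ≤ R) (hv₂ : ‖v₂‖ ≤ R)
    (F : C(TimeInterval T, VecSobolev d (p + 1 + 2)))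
    (hF : ∀ t, F t = ((v₁ t - v₂ t : SobolevSigma d (p + 1 + 2)) : VecSobolev d (p + 1 + 2)))
    {D : ℝ} (hD : ∀ t ∈ Set.Icc 0 T, ∀ j, SobolevBound (p + 2) (vecCoeff (primitive hT F t) j) D)
    {w : C(TimeInterval T, Sobolev d (p + 1))}
    (hw : ∀ t, (w t).coeff = (φ₁ t).coeff - (φ₂ t).coeff) {t : ℝ} (ht : t ∈ Set.Icc 0 T) :
    ‖w (Set.projIcc 0 T hT t)‖ ^ 2 ≤ (2 * Real.pi) ^ d *
      (t * (4 * (advConst d (p + 2) * (D * aprioriBound d (p + 1) T R)) +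
          4 * (advConst d (p + 1) * (D * (2 * aprioriBound d (p + 1) T R +
            2 * (advConst d (p + 2) * (R ^ 2 * aprioriBound d (p + 1) T R)))))) +
        2 * (advConst d (p + 1) * (R ^ 2 *
          ∫ s in (0 : ℝ)..t, ‖w (Set.projIcc 0 T hT s)‖ ^ 2)) +
        2 * (advConst d (p + 2) * (D * aprioriBound d (p + 1) T R))) := by
  have hwc : Continuous fun t => ‖w (Set.projIcc 0 T hT t)‖ ^ 2 :=
    (continuous_comp_projIcc hT w).norm.pow 2
  have hdiv : ∀ t, DivFree (vecCoeff (F t)) := fun t => by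
    rw [hF]
    exact SobolevSigma.divFree (v₁ t - v₂ t)
  have hFcoeff : ∀ j n t, vecCoeff (F t) j n =
      vecCoeff (v₁ t : VecSobolev d (p + 1 + 2)) j n -
        vecCoeff (v₂ t : VecSobolev d (p + 1 + 2)) j n := fun j n t => by
    rw [hF]
    exact map_sub (vecCoeffL j n) (v₁ t : VecSobolev d (p + 1 + 2)) (v₂ t)
  have h3 := sobolevBound_sub_of_solutions (p := p) hk (T := T)
    (v₁ := fun t => vecCoeff (v₁ (Set.projIcc 0 T hT t) : VecSobolev d (p + 1 + 2)))
    (v₂ := fun t => vecCoeff (v₂ (Set.projIcc 0 T hT t) : VecSobolev d (p + 1 + 2)))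
    (V := fun t => vecCoeff (primitive hT F t))
    (a₁ := fun t => (φ₁ (Set.projIcc 0 T hT t)).coeff)
    (a₂ := fun t => (φ₂ (Set.projIcc 0 T hT t)).coeff)
    (N := fun t => ‖w (Set.projIcc 0 T hT t)‖ ^ 2) hwc (Q := R ^ 2)
    (M := aprioriBound d (p + 1) T R) (D := D)
    (fun t j => sobolevBound_vecPath v₁ hv₁ _ j) (fun t j => sobolevBound_vecPath v₂ hv₂ _ j)
    (fun t => (Sobolev.sobolevBound _).mono (h₂.norm_sq_le hk hf hv₂ _)) hD
    (fun _ _ => vecCoeff_zero _ _) (fun _ _ => vecCoeff_zero _ _)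
    (fun _ => Sobolev.coeff_zero _) (fun _ => Sobolev.coeff_zero _)
    (fun _ _ => vecCoeff_zero _ _) (divFree_primitive hdiv)
    (fun n => (Sobolev.coeffL n).continuous.comp (continuous_comp_projIcc hT φ₁))
    (fun n => (Sobolev.coeffL n).continuous.comp (continuous_comp_projIcc hT φ₂))
    (fun n t ht => h₁.hasDerivAt_coeff hk n ht) (fun n t ht => h₂.hasDerivAt_coeff hk n ht)
    (fun j n t => by
      rw [← hFcoeff]
      exact hasDerivAt_vecCoeff_primitive F j n t)
    (by rw [Set.projIcc_left, h₁.initial, h₂.initial])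
    (vecCoeff_primitive_zero F)
    (fun t => by
      rw [← hw]
      exact Sobolev.sobolevBound _) ht
  rw [← hw] at h3
  have h4 := Sobolev.norm_sq_le h3
  rw [intervalIntegral.integral_add (continuous_const.intervalIntegrable _ _)
    ((((hwc.const_mul _).const_mul _).const_mul _).intervalIntegrable _ _),
    intervalIntegral.integral_const, smul_eq_mul, sub_zero] at h4
  simpa only [intervalIntegral.integral_const_mul] using h4

end AdvDiff

end

theorem theorem3p2 (d k : ℕ) (hd : 2 ≤ d) (hk : (d : ℝ) / 2 < k) (T R : ℝ) (hT : 0 < T)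
    (hR : 0 < R) :
    ∃ C : ℝ, 0 < C ∧
      ∀ (f : Sobolev d (k + 2)) (v₁ v₂ : C(TimeInterval T, SobolevSigma d (k + 2)))
        (φ₁ φ₂ : C(TimeInterval T, Sobolev d (k + 2))),
        IsSolution hT.le v₁ f φ₁ → IsSolution hT.le v₂ f φ₂ →
        ‖f‖ + ‖v₁‖ + ‖v₂‖ ≤ R →
        ‖inclC (Nat.le_add_right k 2) φ₁ - inclC (Nat.le_add_right k 2) φ₂‖ ≤
          C * relaxationNorm (fun t =>
            SobolevSigma.toVec (Nat.le_add_right k 2) (v₁ t - v₂ t)) ^ (1 / 2 : ℝ) := by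
  have hk' : d < 2 * k := by
    have h1 : (d : ℝ) < 2 * k := by linarith
    exact_mod_cast h1
  obtain ⟨p, rfl⟩ : ∃ p, k = p + 1 := ⟨k - 1, by omega⟩
  set P : ℝ := (2 * Real.pi) ^ d
  set M : ℝ := aprioriBound d (p + 1) T R
  set c₁ : ℝ := advConst d (p + 1)
  set c₂ : ℝ := advConst d (p + 2)
  have hP0 : 0 ≤ P := by positivity
  have hM0 : 0 ≤ M := aprioriBound_nonneg _ _ _ _
  have hc₁0 : 0 ≤ c₁ := advConst_nonneg _ _
  have hc₂0 : 0 ≤ c₂ := advConst_nonneg _ _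
  set Ψ : ℝ := 2 * M + 2 * (c₂ * (R ^ 2 * M))
  have hΨ0 : 0 ≤ Ψ := by positivity
  set α : ℝ := T * (4 * (c₂ * M) + 4 * (c₁ * Ψ)) + 2 * (c₂ * M) with hα
  have hα0 : 0 ≤ α := by positivity
  set β : ℝ := P * (2 * (c₁ * R ^ 2)) with hβ
  have hβ0 : 0 ≤ β := by positivity
  set C₀ : ℝ := P * (T * R * α) * Real.exp (β * T) with hC₀
  have hC₀0 : 0 ≤ C₀ := by positivity
  -- The summand `1` only serves to make the constant positive.
  refine ⟨Real.sqrt C₀ + 1, by positivity, ?_⟩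
  intro f v₁ v₂ φ₁ φ₂ h₁ h₂ hle
  have hf : ‖f‖ ≤ R := by linarith [norm_nonneg v₁, norm_nonneg v₂]
  have hv₁ : ‖v₁‖ ≤ R := by linarith [norm_nonneg f, norm_nonneg v₂]
  have hv₂ : ‖v₂‖ ≤ R := by linarith [norm_nonneg f, norm_nonneg v₁]
  let F : C(TimeInterval T, VecSobolev d (p + 1 + 2)) :=
    ⟨fun t => ((v₁ t - v₂ t : SobolevSigma d (p + 1 + 2)) : VecSobolev d (p + 1 + 2)),
      continuous_subtype_val.comp (v₁.continuous.sub v₂.continuous)⟩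
  have hF : ‖F‖ ≤ R := by
    refine (F.norm_le hR.le).2 fun t => ?_
    have h3 : ‖F t‖ ≤ ‖v₁ t‖ + ‖v₂ t‖ := norm_sub_le (v₁ t) (v₂ t)
    linarith [v₁.norm_coe_le_norm t, v₂.norm_coe_le_norm t, norm_nonneg f]
  let w : C(TimeInterval T, Sobolev d (p + 1)) :=
    inclC (Nat.le_add_right (p + 1) 2) φ₁ - inclC (Nat.le_add_right (p + 1) 2) φ₂
  set ρ : ℝ := relaxationNorm (fun t =>
    SobolevSigma.toVec (Nat.le_add_right (p + 1) 2) (v₁ t - v₂ t))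
  have hρ0 : 0 ≤ ρ := Real.iSup_nonneg fun _ => norm_nonneg _
  have hwcoeff : ∀ t, (w t).coeff = (φ₁ t).coeff - (φ₂ t).coeff := fun t => by
    rw [← Sobolev.coeff_incl (Nat.le_add_right (p + 1) 2) (φ₁ t),
      ← Sobolev.coeff_incl (Nat.le_add_right (p + 1) 2) (φ₂ t), ← Sobolev.coeff_sub]
    rfl
  have hwc : Continuous fun t => ‖w (Set.projIcc 0 T hT.le t)‖ ^ 2 :=
    (continuous_comp_projIcc hT.le w).norm.pow 2
  have hV : ∀ t ∈ Set.Icc 0 T, ∀ j,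
      SobolevBound (p + 2) (vecCoeff (primitive hT.le F t) j) (ρ * (T * R)) :=
    fun t ht j => sobolevBound_primitive (hT := hT.le) F hF ht j
  have hmain : ∀ t ∈ Set.Icc 0 T, ‖w (Set.projIcc 0 T hT.le t)‖ ^ 2 ≤
      P * (T * R * α) * ρ + β * ∫ s in (0 : ℝ)..t, ‖w (Set.projIcc 0 T hT.le s)‖ ^ 2 := by
    intro t ht
    have h4 := h₁.norm_sub_sq_le hk' h₂ hf hv₁ hv₂ F (fun _ => rfl) hV hwcoeff ht
    refine h4.trans ?_
    have h5 : t * (4 * (c₂ * (ρ * (T * R) * M)) + 4 * (c₁ * (ρ * (T * R) * Ψ))) ≤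
        T * (4 * (c₂ * (ρ * (T * R) * M)) + 4 * (c₁ * (ρ * (T * R) * Ψ))) :=
      mul_le_mul_of_nonneg_right ht.2 (by positivity)
    have h6 := mul_le_mul_of_nonneg_left h5 hP0
    rw [hα, hβ]
    linarith
  have hfinal : ∀ t : TimeInterval T, ‖w t‖ ≤ Real.sqrt C₀ * ρ ^ (1 / 2 : ℝ) := by
    intro t
    have h3 := le_mul_exp_of_le_add_integral hwc hβ0 hmain t t.2
    rw [Set.projIcc_val] at h3
    have h4 : ‖w t‖ ^ 2 ≤ C₀ * ρ := by
      refine h3.trans ?_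
      have h5 : Real.exp (β * t) ≤ Real.exp (β * T) :=
        Real.exp_le_exp.2 (mul_le_mul_of_nonneg_left t.2.2 hβ0)
      calc _ ≤ P * (T * R * α) * ρ * Real.exp (β * T) := by gcongr
        _ = C₀ * ρ := by rw [hC₀]; ring
    rw [← Real.sqrt_eq_rpow, ← Real.sqrt_mul hC₀0]
    exact Real.le_sqrt_of_sq_le h4
  refine (ContinuousMap.norm_le _ (by positivity)).2 fun t => ?_
  refine (hfinal t).trans ?_
  gcongr
  linarith
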